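/- Setting. Let $(\Omega,\mathcal B,\mu)$ be a probability space, $T:\Omega\to\Omega$ a measure-preserving, mixing transformation, and $\widehat T:\mathcal L^1\to\mathcal L^1$ its transfer operator, i.e. $\int \widehat Tf\cdot g\,d\mu=\int f\cdot g\circ T\,d\mu$ for all $f\in\mathcal L^1$, $g\in\mathcal L^\infty$. Let $\mathcal F$ be a set of (real- or complex-valued) measurable functions, identified when equal $\mu$-a.e., which contains the constants and is a Banach algebra under pointwise operations and a norm $\|\cdot\|$ with $\|f\|\ge|f|_\infty$ for $f\in\mathcal F$. Assume that $\widehat T$ restricts to a bounded operator on $\mathcal F$ with a spectral gap: $\widehat T=\lambda P+N$ on $\mathcal F$ with a scalar $\lambda$ and bounded linear $P,N$ such that $P^2=P$, $\dim \operatorname{Im}P=1$, the spectral radius of $N$ is less than $|\lambda|$, and $PN=NP=0$. Let $\chi:\Omega\to\mathbb R_{\ge0}$ be measurable and suppose there are $K_1,K_2>0$ such that for all $\ell>0$ the functions $\chi\cdot\mathbf 1_{\{\chi\le\ell\}}$ and $\mathbf 1_{\{\chi>\ell\}}$ belong to $\mathcal F$ with $\|\chi\cdot\mathbf 1_{\{\chi\le\ell\}}\|\le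 K_1\ell$ and $\|\mathbf 1_{\{\chi>\ell\}}\|\le K_2$ (these assumptions together are Property $\mathfrak D$). For $n\in\mathbb N$ and $b\in\mathbb N_0$ let $\mathsf S_n^b\chi$ be the sum $\chi+\chi\circ T+\dots+\chi\circ T^{n-1}$ with its $b$ largest terms removed (and $\mathsf S_n^b\chi=0$ if $b\ge n$). Let $\Psi$ be the set of all $u:\mathbb N\to\mathbb R_{>0}$ with $\sum_n 1/u(n)<\infty$. Theorem. In this setting assume that there is $K_3>0$ such that $\mathbf 1_{\{\chi=\ell\}}\in\mathcal F$ and $\|\mathbf 1_{\{\chi=\ell\}}\|\le K_3$ for all $\ell>0$. Let $q\in(0,1)$, $R\in(0,1/q)$ and $\eta>1/q$ be such that $\mu(\chi=\eta^k)=R\,q^k$ for all $k\in\mathbb N=\{1,2,\dots\}$, and such that $\chi$ almost surely takes no value in $(\eta,\infty)$ other than powers $\eta^k$. Let $(b_n)$ be a sequence of natural numbers tending to infinity with $b_n=o(n)$, and let $\psi\in\Psi$ satisfy $$\lim_{n\to\infty}\frac{b_n}{\log\psi(\lfloor\log n\rfloor)}=\infty .$$ Then there is a sequence $(d_n)$ of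 positive reals with $$\lim_{n\to\infty}\frac{\mathsf S_n^{b_n}\chi}{d_n}=1\quad\text{a.s.}$$ If, in addition, there are $\epsilon>0$, a sequence $(k_n)$ of natural numbers and a real sequence $(w_n)$ such that, for all sufficiently large $n$, $$b_n=\frac{R}{1-q}\,q^{k_n}n+w_n,\qquad w_n\ge (q^{k_n}n)^{1/2+\epsilon}\,\bigl(\log\psi(\lfloor\log n\rfloor)\bigr)^{1/2-\epsilon},$$ and $w_n=o(q^{k_n}n)$, then the almost sure convergence holds with $$d_n=\frac{\eta}{q\eta-1}\,(Rq)^{-\log\eta/\log q}\,(1-q)^{1+\log\eta/\log q}\,n^{-\log\eta/\log q}\,b_n^{1+\log\eta/\log q}.$$ -/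

import Mathlib

open MeasureTheory Filter Topology Asymptotics
open scoped ENNReal

noncomputable section

namespace TrimmedSums

/-- The spectral radius of a bounded operator on a real or complex Banach space, through the
limit `lim ‖N ^ n‖ ^ (1 / n)`. Over `ℂ` this is the largest modulus in the spectrum
(`opSpectralRadius_eq_spectralRadius`); over `ℝ` it is the spectral radius of the
complexification. -/
def opSpectralRadius {𝕜 E : Type*} [RCLike 𝕜] [NormedAddCommGroup E] [NormedSpace 𝕜 E]
    (N : E →L[𝕜] E) : ℝ≥0∞ :=
  limsup (fun n : ℕ => (‖N ^ n‖₊ : ℝ≥0∞) ^ (1 / n : ℝ)) atTop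

theorem opSpectralRadius_eq_spectralRadius {E : Type*} [NormedAddCommGroup E]
    [NormedSpace ℂ E] [CompleteSpace E] (N : E →L[ℂ] E) :
    opSpectralRadius N = spectralRadius ℂ N :=
  (spectrum.pow_nnnorm_pow_one_div_tendsto_nhds_spectralRadius N).limsup_eq

/-- `U` has a spectral gap: `U = c P + N` with `P` a projection onto a one-dimensional space,
`ρ(N) < |c|` and `P N = N P = 0`. -/
def HasSpectralGap {𝕜 E : Type*} [RCLike 𝕜] [NormedAddCommGroup E] [NormedSpace 𝕜 E]
    (U : E →L[𝕜] E) : Prop :=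
  ∃ (c : 𝕜) (P N : E →L[𝕜] E),
    U = c • P + N ∧
    P * P = P ∧
    Module.finrank 𝕜 (LinearMap.range (P : E →ₗ[𝕜] E)) = 1 ∧
    opSpectralRadius N < (‖c‖₊ : ℝ≥0∞) ∧
    P * N = 0 ∧ N * P = 0

/-- `μ(A ∩ T⁻ⁿ B) → μ(A) μ(B)` for all measurable `A`, `B`. -/
def IsMixing {Ω : Type*} [MeasurableSpace Ω] (T : Ω → Ω) (μ : Measure Ω) : Prop :=
  ∀ A B : Set Ω, MeasurableSet A → MeasurableSet B →
    Tendsto (fun n : ℕ => μ (A ∩ T^[n] ⁻¹' B)) atTop (𝓝 (μ A * μ B))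

/-- `h` is (a version of) the image of the integrable function `f` under the transfer operator
of `T`: `h` is integrable and `∫ h g dμ = ∫ f (g ∘ T) dμ` for all `g ∈ L^∞`. -/
def IsTransfer {Ω 𝕜 : Type*} [MeasurableSpace Ω] [RCLike 𝕜] (T : Ω → Ω) (μ : Measure Ω)
    (f h : Ω → 𝕜) : Prop :=
  Integrable h μ ∧
    ∀ g : Ω → 𝕜, MemLp g ⊤ μ → ∫ ω, h ω * g ω ∂μ = ∫ ω, f ω * g (T ω) ∂μ

section

variable {Ω 𝕜 F : Type*} [MeasurableSpace Ω] [RCLike 𝕜] {μ : Measure Ω}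
  [NormedCommRing F] [NormedAlgebra 𝕜 F]

/-- The Banach algebra `F` is, through `ι`, an algebra of measurable functions (modulo equality
`μ`-almost everywhere), it contains the constant functions, `T` preserves the mixing probability
measure `μ`, the norm of `F` dominates the `L^∞` norm, and the transfer operator of `T`
restricts to a bounded operator of `F` that has a spectral gap. -/
structure PropertyC (T : Ω → Ω) (ι : F →ₗ[𝕜] (Ω →ₘ[μ] 𝕜)) : Prop where
  complete : CompleteSpace F
  injective : Function.Injective ι
  map_mul : ∀ f g : F, ι (f * g) = ι f * ι g
  map_one : ι 1 = 1
  isProbability : IsProbabilityMeasure μ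
  invariant : MeasurePreserving T μ μ
  mixing : IsMixing T μ
  norm_ge : ∀ f : F, eLpNorm (ι f) ⊤ μ ≤ (‖f‖₊ : ℝ≥0∞)
  transfer : ∃ U : F →L[𝕜] F, (∀ f : F, IsTransfer T μ (ι f) (ι (U f))) ∧ HasSpectralGap U

/-- The real function `g` belongs to the algebra `F` of functions and has `F`-norm at
most `C`. -/
def MemNormLE (ι : F →ₗ[𝕜] (Ω →ₘ[μ] 𝕜)) (g : Ω → ℝ) (C : ℝ) : Prop :=
  ∃ f : F, (ι f =ᵐ[μ] fun ω => ((g ω : ℝ) : 𝕜)) ∧ ‖f‖ ≤ C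

/-- Property C together with: `χ` is a nonnegative measurable function, and for all `ℓ > 0`,
`‖χ 1_{χ ≤ ℓ}‖ ≤ K₁ ℓ` and `‖1_{χ > ℓ}‖ ≤ K₂`. -/
structure PropertyD (T : Ω → Ω) (ι : F →ₗ[𝕜] (Ω →ₘ[μ] 𝕜)) (χ : Ω → ℝ) : Prop where
  propertyC : PropertyC T ι
  measurable : Measurable χ
  nonneg : ∀ ω, 0 ≤ χ ω
  truncation : ∃ K₁ > 0, ∀ ℓ > 0, MemNormLE ι ({ω | χ ω ≤ ℓ}.indicator χ) (K₁ * ℓ)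
  level : ∃ K₂ > 0, ∀ ℓ > 0, MemNormLE ι ({ω | ℓ < χ ω}.indicator 1) K₂

end

/-- A permutation that lists `χ ω, χ (T ω), …, χ (T^(n-1) ω)` in decreasing order. -/
def decreasingOrder {Ω : Type*} (T : Ω → Ω) (χ : Ω → ℝ) (n : ℕ) (ω : Ω) :
    Equiv.Perm (Fin n) :=
  Tuple.sort fun i : Fin n => -χ (T^[i] ω)

theorem antitone_decreasingOrder {Ω : Type*} (T : Ω → Ω) (χ : Ω → ℝ) (n : ℕ) (ω : Ω) :
    Antitone fun k : Fin n => χ (T^[decreasingOrder T χ n ω k] ω) := fun _ _ h =>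
  neg_le_neg_iff.1 (Tuple.monotone_sort (fun i : Fin n => -χ (T^[i] ω)) h)

/-- `S_n^b χ`: the sum of `χ ω, …, χ (T^(n-1) ω)` without its `b` largest terms. -/
def trimmedSum {Ω : Type*} (T : Ω → Ω) (χ : Ω → ℝ) (n b : ℕ) (ω : Ω) : ℝ :=
  ∑ k ∈ (Finset.univ : Finset (Fin n)).filter fun k : Fin n => b ≤ (k : ℕ),
    χ (T^[decreasingOrder T χ n ω k] ω)

/-- The set `Ψ` of positive sequences with summable reciprocals. -/
def Psi : Set (ℕ → ℝ) :=
  {u | (∀ n, 0 < u n) ∧ Summable fun n => 1 / u n}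

end TrimmedSums

end

/-!
The terms of a Birkhoff sum of `χ` that exceed `η` are powers of `η`, so a trimmed sum is
determined, up to an error of at most `n η`, by the numbers `N j` of visits to the level sets
`{η ^ (j + 1) < χ}` before time `n`: the layer above `η ^ (j + 1)` has height
`(η - 1) η ^ (j + 1)` and, after the `b` largest terms are removed, it is counted `(N j - b)⁺`
times (`exists_hasSum_visits`). The expectation of `N j` is `n c q ^ j` with
`c = R q² / (1 - q)`. Replacing `N j` by it gives the deterministic constant `normalizer`.

The visits are controlled by a Bernstein type inequality. For the number `S` of visits to a set `A`
whose indicator lies in the algebra, `E (1 + z) ^ S` is the mean of the `n`-th iterate of `1` under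
the twisted transfer operator `h ↦ U ((1 + z 1_A) h)`. By the spectral gap, `U f - ∫ f` is a
contraction in an adapted norm, and an induction on `n` shows that the iterate stays within relative
distance `O(z)` of its mean. One more integration against `1_A` turns this error into `O(z² μ(A))`,
whence `E (1 + z) ^ S ≤ exp (n μ(A) (z + C z²))` with a constant that depends on `A` only through
the norm of `1_A` (`PropertyC.exists_integral_pow_visits_le`). Hence `S` has a relative deviation
of at least `δ` with probability at most `2 exp (- a n μ(A))`, where `a` depends on `δ`.

The probabilities of a deviation on the levels with `n c q ^ j ≥ κ b n` form a sum dominated by its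
largest term. On the block `⌊log n⌋ = m` it suffices to treat a bounded number of times `n`, because
the number of visits is monotone in `n`. As `b n / log (ψ m)` tends to infinity, the block
contributes `O(1 / ψ m)`, and the Borel–Cantelli lemma yields a strong law uniform over these levels
(`PropertyC.ae_eventually_visits`). The weights of the layers increase geometrically up to the level
where the expected number of visits is about `b`, so a relative error `δ` in the visits causes a
relative error `O(δ)` in the sum (`abs_sub_normalizer_le`), and `normalizer` is a correct
normalization in every case. If `b n ∼ R / (1 - q) q ^ k n * n`, its asymptotic value is obtained by
dominated convergence (`tendsto_normalizer_div`).
-/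

namespace TrimmedSums

/-! ### The spectral gap of the transfer operator -/

section adapted
variable {𝕜 E : Type*} [RCLike 𝕜] [NormedAddCommGroup E] [NormedSpace 𝕜 E]

theorem exists_norm_pow_le_of_opSpectralRadius_lt (N : E →L[𝕜] E) {r : ℝ}
    (h : opSpectralRadius N < ENNReal.ofReal r) :
    ∃ ρ : ℝ, 0 < ρ ∧ ρ < r ∧ ∀ᶠ m : ℕ in atTop, ‖N ^ m‖ ≤ ρ ^ m := by
  obtain ⟨a, ha, har⟩ := exists_between h
  have hat : a ≠ ⊤ := (har.trans ENNReal.ofReal_lt_top).ne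
  have ha0 : 0 < a := lt_of_le_of_lt zero_le ha
  refine ⟨a.toReal, ENNReal.toReal_pos ha0.ne' hat, ?_, ?_⟩
  · exact (ENNReal.lt_ofReal_iff_toReal_lt hat).1 har
  · filter_upwards [eventually_lt_of_limsup_lt ha, eventually_ge_atTop 1] with m hm hm1
    have hm0 : (m : ℝ) ≠ 0 := by positivity
    have h1 : (‖N ^ m‖₊ : ℝ≥0∞) ≤ a ^ m := by
      have := ENNReal.rpow_le_rpow hm.le (Nat.cast_nonneg m)
      rwa [← ENNReal.rpow_mul, one_div, inv_mul_cancel₀ hm0, ENNReal.rpow_one,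
        ENNReal.rpow_natCast] at this
    have h2 := ENNReal.toReal_mono (ENNReal.pow_ne_top hat) h1
    simpa using h2

/-- An adapted norm: an operator `N` of spectral radius less than one is a strict contraction for
the equivalent norm `W g = ∑ j < m, ρ ^ (-j) ‖N ^ j g‖`, where `‖N ^ m‖ ≤ ρ ^ m`. -/
theorem exists_adapted_norm (N : E →L[𝕜] E) (h : opSpectralRadius N < 1) :
    ∃ (W : E → ℝ) (M ρ : ℝ), 0 < ρ ∧ ρ < 1 ∧ 0 < M ∧ (∀ g, ‖g‖ ≤ W g) ∧ (∀ g, W g ≤ M * ‖g‖) ∧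
      (∀ g, W (N g) ≤ ρ * W g) ∧ (∀ f g, W (f + g) ≤ W f + W g) ∧
      (∀ (c : 𝕜) g, W (c • g) = ‖c‖ * W g) := by
  obtain ⟨ρ, hρ, hρ1, hev⟩ := exists_norm_pow_le_of_opSpectralRadius_lt N (r := 1)
    (by simpa using h)
  obtain ⟨m, hm, hm1⟩ := (hev.and (eventually_ge_atTop 1)).exists
  obtain ⟨m, rfl⟩ := Nat.exists_eq_add_of_le' hm1
  refine ⟨fun g => ∑ j ∈ Finset.range (m + 1), ρ⁻¹ ^ j * ‖(N ^ j) g‖,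
    ∑ j ∈ Finset.range (m + 1), ρ⁻¹ ^ j * ‖N ^ j‖ + 1, ρ, hρ, hρ1, by positivity,
    ?_, ?_, ?_, ?_, ?_⟩
  · intro g
    refine le_trans ?_ (Finset.single_le_sum (f := fun j => ρ⁻¹ ^ j * ‖(N ^ j) g‖)
      (fun j _ => by positivity) (Finset.mem_range.2 (Nat.succ_pos m)))
    simp
  · intro g
    rw [add_mul, Finset.sum_mul, one_mul]
    refine le_add_of_le_of_nonneg (Finset.sum_le_sum fun j _ => ?_) (norm_nonneg g)
    rw [mul_assoc]
    gcongr
    exact (N ^ j).le_opNorm g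
  · intro g
    have key : ∀ j, ρ⁻¹ ^ j * ‖(N ^ j) (N g)‖ = ρ * (ρ⁻¹ ^ (j + 1) * ‖(N ^ (j + 1)) g‖) := by
      intro j
      rw [pow_succ N j, mul_apply_eq_comp, pow_succ]
      field_simp
    simp only [key]
    rw [← Finset.mul_sum]
    refine mul_le_mul_of_nonneg_left ?_ hρ.le
    rw [Finset.sum_range_succ, Finset.sum_range_succ']
    refine add_le_add_right ?_ _
    have : ‖(N ^ (m + 1)) g‖ ≤ ρ ^ (m + 1) * ‖g‖ := (N ^ (m + 1)).le_of_opNorm_le hm g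
    calc ρ⁻¹ ^ (m + 1) * ‖(N ^ (m + 1)) g‖ ≤ ρ⁻¹ ^ (m + 1) * (ρ ^ (m + 1) * ‖g‖) := by gcongr
      _ = ρ⁻¹ ^ 0 * ‖(N ^ 0) g‖ := by
        rw [← mul_assoc, ← mul_pow, inv_mul_cancel₀ hρ.ne']; simp
  · intro f g
    rw [← Finset.sum_add_distrib]
    refine Finset.sum_le_sum fun j _ => ?_
    rw [← mul_add, map_add]
    gcongr
    exact norm_add_le _ _
  · intro c g
    rw [Finset.mul_sum]
    refine Finset.sum_congr rfl fun j _ => ?_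
    rw [map_smul, norm_smul]; ring

end adapted

theorem integral_comp_of_measurePreserving {Ω G : Type*} [MeasurableSpace Ω] {μ : Measure Ω}
    [NormedAddCommGroup G] [NormedSpace ℝ G] {T : Ω → Ω} (hT : MeasurePreserving T μ μ) {g : Ω → G}
    (hg : AEStronglyMeasurable g μ) : ∫ ω, g (T ω) ∂μ = ∫ ω, g ω ∂μ := by
  rw [← integral_map hT.aemeasurable (by rwa [hT.map_eq]), hT.map_eq]

section spectral
variable {Ω 𝕜 F : Type*} [MeasurableSpace Ω] [RCLike 𝕜] {μ : Measure Ω}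
  [NormedCommRing F] [NormedAlgebra 𝕜 F] {T : Ω → Ω} {ι : F →ₗ[𝕜] (Ω →ₘ[μ] 𝕜)}

theorem PropertyC.ae_norm_le (hC : PropertyC T ι) (f : F) : ∀ᵐ ω ∂μ, ‖ι f ω‖ ≤ ‖f‖ := by
  have h1 : ∀ᵐ ω ∂μ, ‖ι f ω‖ₑ ≤ eLpNorm (ι f) ⊤ μ := by
    rw [eLpNorm_exponent_top]; exact enorm_ae_le_eLpNormEssSup _ _
  filter_upwards [h1] with ω hω
  have := hω.trans (hC.norm_ge f)
  rw [enorm_eq_nnnorm] at this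
  exact_mod_cast this

theorem PropertyC.memLp_top (hC : PropertyC T ι) (f : F) : MemLp (ι f) ⊤ μ :=
  ⟨(ι f).aestronglyMeasurable, (hC.norm_ge f).trans_lt ENNReal.coe_lt_top⟩

theorem PropertyC.integrable (hC : PropertyC T ι) (f : F) : Integrable (ι f) μ :=
  have := hC.isProbability
  (hC.memLp_top f).integrable le_top

/-- The integral with respect to `μ`, as a linear form on the algebra of functions. -/
noncomputable def mean (ι : F →ₗ[𝕜] (Ω →ₘ[μ] 𝕜)) (f : F) : 𝕜 := ∫ ω, ι f ω ∂μ

theorem PropertyC.mean_add (hC : PropertyC T ι) (f g : F) :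
    mean ι (f + g) = mean ι f + mean ι g := by
  unfold mean
  rw [← integral_add (hC.integrable f) (hC.integrable g), _root_.map_add]
  exact integral_congr_ae (AEEqFun.coeFn_add _ _)

theorem mean_smul (c : 𝕜) (f : F) : mean ι (c • f) = c * mean ι f := by
  unfold mean
  rw [← integral_const_mul, map_smul]
  exact integral_congr_ae (AEEqFun.coeFn_smul _ _)

theorem PropertyC.mean_one (hC : PropertyC T ι) : mean ι (1 : F) = 1 := by
  have := hC.isProbability
  unfold mean
  rw [hC.map_one]
  rw [integral_congr_ae (AEEqFun.coeFn_one)]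
  simp

theorem PropertyC.norm_mean_le (hC : PropertyC T ι) (f : F) : ‖mean ι f‖ ≤ ‖f‖ := by
  have := hC.isProbability
  have := norm_integral_le_of_norm_le_const (hC.ae_norm_le f)
  simpa [mean] using this

theorem PropertyC.mean_transfer (hC : PropertyC T ι) {U : F →L[𝕜] F}
    (hU : ∀ f : F, IsTransfer T μ (ι f) (ι (U f))) (f : F) : mean ι (U f) = mean ι f := by
  have := hC.isProbability
  have := (hU f).2 (fun _ => 1) (memLp_const 1)
  simpa [mean] using this

/-- The transfer operator fixes the constants, because `T` preserves `μ`. -/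
theorem PropertyC.transfer_one (hC : PropertyC T ι) {U : F →L[𝕜] F}
    (hU : ∀ f : F, IsTransfer T μ (ι f) (ι (U f))) : U 1 = 1 := by
  have := hC.isProbability
  apply hC.injective
  rw [hC.map_one]
  refine AEEqFun.ext ?_
  have h1 : Integrable (fun _ : Ω => (1 : 𝕜)) μ := integrable_const 1
  refine ((hU 1).1.ae_eq_of_forall_setIntegral_eq _ _ h1 ?_).trans AEEqFun.coeFn_one.symm
  intro s hs _
  have hg : MemLp (s.indicator fun _ => (1 : 𝕜)) ⊤ μ := (memLp_const 1).indicator hs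
  have h := (hU 1).2 _ hg
  have e1 : ∫ ω, ι (U 1) ω * s.indicator (fun _ => (1 : 𝕜)) ω ∂μ = ∫ ω in s, ι (U 1) ω ∂μ := by
    rw [← integral_indicator hs]
    congr 1; ext ω
    by_cases hω : ω ∈ s <;> simp [hω]
  have e2 : ∫ ω, ι (1 : F) ω * s.indicator (fun _ => (1 : 𝕜)) (T ω) ∂μ
      = ∫ ω in s, (1 : 𝕜) ∂μ := by
    rw [← integral_indicator hs,
      ← integral_comp_of_measurePreserving hC.invariant (aestronglyMeasurable_const.indicator hs)]
    refine integral_congr_ae ?_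
    rw [hC.map_one]
    filter_upwards [AEEqFun.coeFn_one (μ := μ) (α := Ω) (β := 𝕜)] with ω hω
    rw [hω]; simp
  rw [← e1, h, e2]

/-- An eigenvalue of the transfer operator has modulus at most one: test the eigenfunction
against its own conjugate. -/
theorem PropertyC.norm_eigenvalue_le (hC : PropertyC T ι) {U : F →L[𝕜] F}
    (hU : ∀ f : F, IsTransfer T μ (ι f) (ι (U f))) {c : 𝕜} {f : F} (hf : f ≠ 0)
    (hc : U f = c • f) : ‖c‖ ≤ 1 := by
  have := hC.isProbability
  have hL := hC.memLp_top f
  have hL2 : MemLp (ι f) 2 μ := hL.mono_exponent le_top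
  have hint : Integrable (fun ω => ‖ι f ω‖ ^ 2) μ := hL2.integrable_norm_pow (by norm_num)
  have hTint : Integrable (fun ω => ‖ι f (T ω)‖ ^ 2) μ :=
    (hC.invariant.integrable_comp hint.aestronglyMeasurable).2 hint
  have hTeq : ∫ ω, ‖ι f (T ω)‖ ^ 2 ∂μ = ∫ ω, ‖ι f ω‖ ^ 2 ∂μ :=
    integral_comp_of_measurePreserving hC.invariant hint.aestronglyMeasurable
  have hpos : 0 < ∫ ω, ‖ι f ω‖ ^ 2 ∂μ := by
    refine lt_of_le_of_ne (integral_nonneg fun ω => by positivity) fun h0 => hf ?_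
    have h0' := (integral_eq_zero_iff_of_nonneg (fun ω => by positivity) hint).1 h0.symm
    apply hC.injective
    rw [_root_.map_zero]
    refine AEEqFun.ext ?_
    filter_upwards [h0', AEEqFun.coeFn_zero (μ := μ) (α := Ω) (β := 𝕜)] with ω h1 h2
    rw [h2]; simpa using h1
  have hstar : MemLp (fun ω => (starRingEnd 𝕜) (ι f ω)) ⊤ μ := hL.star
  have h := (hU f).2 _ hstar
  rw [hc] at h
  have e1 : ∫ ω, ι (c • f) ω * (starRingEnd 𝕜) (ι f ω) ∂μ
      = c * ((∫ ω, ‖ι f ω‖ ^ 2 ∂μ : ℝ) : 𝕜) := by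
    rw [← integral_ofReal, ← integral_const_mul, map_smul]
    refine integral_congr_ae ?_
    filter_upwards [AEEqFun.coeFn_smul c (ι f)] with ω hω
    rw [hω, Pi.smul_apply, smul_eq_mul, mul_assoc, RCLike.mul_conj]
    push_cast; rfl
  have e2 : ‖∫ ω, ι f ω * (starRingEnd 𝕜) (ι f (T ω)) ∂μ‖ ≤ ∫ ω, ‖ι f ω‖ ^ 2 ∂μ := by
    have hi : Integrable (fun ω => (‖ι f ω‖ ^ 2 + ‖ι f (T ω)‖ ^ 2) / 2) μ :=
      (hint.add hTint).div_const 2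
    refine (norm_integral_le_of_norm_le hi (Eventually.of_forall fun ω => ?_)).trans ?_
    · rw [norm_mul, RCLike.norm_conj]
      nlinarith [sq_nonneg (‖ι f ω‖ - ‖ι f (T ω)‖)]
    · rw [integral_div, integral_add hint hTint, hTeq]
      linarith
  rw [← h, e1, norm_mul, RCLike.norm_ofReal, abs_of_pos hpos] at e2
  exact le_of_mul_le_mul_right (by simpa using e2) hpos

/-- The spectral gap of a transfer operator is at the eigenvalue `1`, and the spectral
projection is the integral: up to an operator `N` of spectral radius less than one that kills
the constants, the transfer operator is `f ↦ ∫ f dμ`. -/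
theorem PropertyC.exists_decomposition (hC : PropertyC T ι) :
    ∃ U N : F →L[𝕜] F, (∀ f : F, IsTransfer T μ (ι f) (ι (U f))) ∧ opSpectralRadius N < 1 ∧
      N 1 = 0 ∧ ∀ f, U f = mean ι f • (1 : F) + N f := by
  have := hC.isProbability
  obtain ⟨U, hU, c, P, N, hUPN, hPP, hrank, hgap, hPN, hNP⟩ := hC.transfer
  have app : ∀ {A B C : F →L[𝕜] F}, A * B = C → ∀ x, A (B x) = C x := by
    rintro A B _ rfl x; rfl
  have hUP : ∀ x, U (P x) = c • P x := fun x => by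
    rw [hUPN]; simp [app hPP, app hNP]
  have hPU : ∀ x, P (U x) = c • P x := fun x => by
    rw [hUPN]; simp [app hPP, app hPN]
  have hP0 : P ≠ 0 := by
    rintro rfl
    rw [ContinuousLinearMap.toLinearMap_zero, LinearMap.range_zero, finrank_bot] at hrank
    exact zero_ne_one hrank
  obtain ⟨x, hx⟩ : ∃ x, P x ≠ 0 := by
    by_contra! h
    exact hP0 (ContinuousLinearMap.ext h)
  have hc1 : ‖c‖ ≤ 1 := hC.norm_eigenvalue_le hU hx (hUP x)
  have hN1 : opSpectralRadius N < 1 := hgap.trans_le (by exact_mod_cast hc1)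
  obtain ⟨ρ, hρ, hρ1, hev⟩ := exists_norm_pow_le_of_opSpectralRadius_lt N (r := 1)
    (by simpa using hN1)
  have hNt : ∀ f, Tendsto (fun m => (N ^ m) f) atTop (𝓝 0) := fun f => by
    refine squeeze_zero_norm' (hev.mono fun m hm => (N ^ m).le_of_opNorm_le hm f) ?_
    simpa using (tendsto_pow_atTop_nhds_zero_of_lt_one hρ.le hρ1).mul_const ‖f‖
  have h10 : (1 : F) ≠ 0 := fun h => by
    have h2 : mean ι (0 : F) = 0 := by simpa using mean_smul (ι := ι) (0 : 𝕜) (0 : F)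
    exact absurd hC.mean_one (by rw [h, h2]; simp)
  have hU1 : U 1 = 1 := hC.transfer_one hU
  -- If `P 1 = 0`, the constants would lie in the contracting part.
  have hP1 : P 1 ≠ 0 := fun h0 => by
    have hN : N 1 = 1 := by
      have := hU1
      rw [hUPN] at this
      simpa [h0] using this
    have : ∀ m, (N ^ m) 1 = 1 := fun m => by
      induction m with
      | zero => simp
      | succ m ih => rw [pow_succ, mul_apply_eq_comp, hN, ih]
    have h2 := hNt 1
    simp only [this] at h2
    exact h10 (tendsto_nhds_unique tendsto_const_nhds h2)
  have hc : c = 1 := by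
    have h1 : c • P 1 = P 1 := by rw [← hPU, hU1]
    have h2 : (c - 1) • P 1 = 0 := by rw [sub_smul, h1]; simp
    rcases smul_eq_zero.1 h2 with h | h
    · exact sub_eq_zero.1 h
    · exact absurd h hP1
  subst hc
  have hUN : ∀ f, U f = P f + N f := fun f => by rw [hUPN]; simp
  have hpow : ∀ f m, (U ^ (m + 1)) f = P f + (N ^ (m + 1)) f := fun f m => by
    induction m with
    | zero => simp [hUN]
    | succ m ih =>
      rw [pow_succ' U, mul_apply_eq_comp, ih, map_add, hUP, one_smul, hUN,
        pow_succ' N (m + 1), mul_apply_eq_comp]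
      congr 1
      rw [pow_succ' N m, mul_apply_eq_comp, app hPN]
      simp
  have hPlim : ∀ f, Tendsto (fun m => (U ^ (m + 1)) f) atTop (𝓝 (P f)) := fun f => by
    simp only [hpow]
    simpa using ((hNt f).comp (tendsto_add_atTop_nat 1)).const_add (P f)
  have hP11 : P 1 = 1 := by
    have : ∀ m, (U ^ (m + 1)) 1 = 1 := fun m => by
      induction m with
      | zero => simpa using hU1
      | succ m ih => rw [pow_succ, mul_apply_eq_comp, hU1, ih]
    have h2 := hPlim 1
    simp only [this] at h2
    exact tendsto_nhds_unique h2 tendsto_const_nhds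
  have hmeanP : ∀ f, mean ι (P f) = mean ι f := fun f => by
    have hconst : ∀ m, mean ι ((U ^ (m + 1)) f) = mean ι f := fun m => by
      induction m with
      | zero => simpa using hC.mean_transfer hU f
      | succ m ih =>
        rw [pow_succ', mul_apply_eq_comp, hC.mean_transfer hU, ih]
    have hsub : ∀ g h : F, mean ι (g - h) = mean ι g - mean ι h := fun g h => by
      rw [sub_eq_add_neg, ← neg_one_smul 𝕜 h, hC.mean_add, mean_smul]; ring
    have h1 : Tendsto (fun m => mean ι ((U ^ (m + 1)) f)) atTop (𝓝 (mean ι (P f))) := by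
      rw [tendsto_iff_norm_sub_tendsto_zero]
      refine squeeze_zero (fun _ => norm_nonneg _) (fun m => ?_)
        (tendsto_iff_norm_sub_tendsto_zero.1 (hPlim f))
      rw [← hsub]
      exact hC.norm_mean_le _
    simp only [hconst] at h1
    exact tendsto_nhds_unique h1 tendsto_const_nhds
  have hPmean : ∀ f, P f = mean ι f • (1 : F) := fun f => by
    have hmem1 : (⟨1, ⟨1, hP11⟩⟩ : LinearMap.range (P : F →ₗ[𝕜] F)) ≠ 0 := fun h =>
      h10 (congrArg Subtype.val h)
    obtain ⟨a, ha⟩ := (finrank_eq_one_iff_of_nonzero' _ hmem1).1 hrank ⟨P f, ⟨f, rfl⟩⟩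
    have ha' : a • (1 : F) = P f := congrArg Subtype.val ha
    have : mean ι f = a := by rw [← hmeanP, ← ha', mean_smul, hC.mean_one, mul_one]
    rw [this, ha']
  refine ⟨U, N, hU, hN1, ?_, fun f => by rw [hUN, hPmean]⟩
  have := hUN 1
  rw [hU1, hP11] at this
  simpa using this

end spectral

/-! ### Exponential moments of the number of visits -/

section visits
variable {Ω 𝕜 : Type*} [RCLike 𝕜]

/-- The function with values in `𝕜` that is `1 + z` on `A` and `1` elsewhere. -/
noncomputable def tilt (𝕜 : Type*) [RCLike 𝕜] (A : Set Ω) (z : ℝ) (ω : Ω) : 𝕜 :=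
  1 + (z : 𝕜) * ((A.indicator 1 ω : ℝ) : 𝕜)

/-- The number of `i < n` for which `T^i ω` lies in `A`. -/
noncomputable def visits (T : Ω → Ω) (A : Set Ω) (n : ℕ) (ω : Ω) : ℕ :=
  open Classical in ((Finset.range n).filter fun i => T^[i] ω ∈ A).card

theorem prod_tilt (T : Ω → Ω) (A : Set Ω) (z : ℝ) (n : ℕ) (ω : Ω) :
    ∏ i ∈ Finset.range n, tilt 𝕜 A z (T^[i] ω) = (((1 + z) ^ visits T A n ω : ℝ) : 𝕜) := by
  classical
  have : ∀ i, tilt 𝕜 A z (T^[i] ω) = if T^[i] ω ∈ A then ((1 + z : ℝ) : 𝕜) else 1 := fun i => by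
    by_cases h : T^[i] ω ∈ A <;> simp [tilt, h]
  simp only [this]
  rw [← Finset.prod_filter, Finset.prod_const, visits]
  push_cast
  congr!

theorem visits_le (T : Ω → Ω) (A : Set Ω) (n : ℕ) (ω : Ω) : visits T A n ω ≤ n := by
  classical
  exact (Finset.card_filter_le _ _).trans_eq (Finset.card_range n)

end visits

section mgf
variable {Ω 𝕜 F : Type*} [MeasurableSpace Ω] [RCLike 𝕜] {μ : Measure Ω}
  [NormedCommRing F] [NormedAlgebra 𝕜 F] {T : Ω → Ω} {ι : F →ₗ[𝕜] (Ω →ₘ[μ] 𝕜)}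

theorem memLp_tilt [IsProbabilityMeasure μ] {A : Set Ω} (hA : MeasurableSet A) (z : ℝ) :
    MemLp (tilt 𝕜 A z) ⊤ μ := by
  have hm : Measurable (tilt 𝕜 A z) := measurable_const.add
    (measurable_const.mul (RCLike.measurable_ofReal.comp (measurable_one.indicator hA)))
  refine memLp_top_of_bound hm.aestronglyMeasurable (1 + |z|) (Eventually.of_forall fun ω => ?_)
  by_cases h : ω ∈ A
  · refine (norm_add_le _ _).trans ?_
    simp [h]
  · simp [tilt, h]

/-- The orbit of `1` under the twisted transfer operator `h ↦ U ((1 + z f) h)`. -/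
noncomputable def twistedOrbit (U : F →L[𝕜] F) (f : F) (z : ℝ) : ℕ → F
  | 0 => 1
  | n + 1 => U (twistedOrbit U f z n + (z : 𝕜) • (f * twistedOrbit U f z n))

/-- Duality: the twisted transfer operator is the transpose of composition with `T` followed by
multiplication by `1 + z 1_A`. -/
theorem PropertyC.integral_twistedOrbit_mul (hC : PropertyC T ι) {U : F →L[𝕜] F}
    (hU : ∀ f : F, IsTransfer T μ (ι f) (ι (U f))) {A : Set Ω} (hA : MeasurableSet A) {f : F}
    (hf : ι f =ᵐ[μ] fun ω => ((A.indicator 1 ω : ℝ) : 𝕜)) (z : ℝ) (n : ℕ) :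
    ∀ g : Ω → 𝕜, MemLp g ⊤ μ → ∫ ω, ι (twistedOrbit U f z n) ω * g ω ∂μ =
      ∫ ω, (∏ i ∈ Finset.range n, tilt 𝕜 A z (T^[i] ω)) * g (T^[n] ω) ∂μ := by
  have := hC.isProbability
  induction n with
  | zero =>
    intro g _
    refine integral_congr_ae ?_
    simp only [twistedOrbit, hC.map_one]
    filter_upwards [AEEqFun.coeFn_one (μ := μ) (α := Ω) (β := 𝕜)] with ω hω
    rw [hω]; simp
  | succ n ih =>
    intro g hg
    have hgT : MemLp (fun ω => g (T ω)) ⊤ μ := hg.comp_measurePreserving hC.invariant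
    have hg' : MemLp (fun ω => g (T ω) * tilt 𝕜 A z ω) ⊤ μ := (memLp_tilt hA z).mul hgT
    rw [twistedOrbit, (hU _).2 g hg]
    trans ∫ ω, ι (twistedOrbit U f z n) ω * (g (T ω) * tilt 𝕜 A z ω) ∂μ
    · refine integral_congr_ae ?_
      rw [_root_.map_add, map_smul, hC.map_mul]
      filter_upwards [hf, AEEqFun.coeFn_add (ι (twistedOrbit U f z n))
          ((z : 𝕜) • (ι f * ι (twistedOrbit U f z n))),
        AEEqFun.coeFn_smul (z : 𝕜) (ι f * ι (twistedOrbit U f z n)),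
        AEEqFun.coeFn_mul (ι f) (ι (twistedOrbit U f z n))] with ω h1 h2 h3 h4
      rw [h2, Pi.add_apply, h3, Pi.smul_apply, h4, Pi.mul_apply, h1, tilt, smul_eq_mul]
      ring
    · rw [ih _ hg']
      congr 1
      ext ω
      rw [Finset.prod_range_succ, ← Function.iterate_succ_apply' T]
      ring

theorem PropertyC.norm_mean_twistedOrbit (hC : PropertyC T ι) {U : F →L[𝕜] F}
    (hU : ∀ f : F, IsTransfer T μ (ι f) (ι (U f))) {A : Set Ω} (hA : MeasurableSet A) {f : F}
    (hf : ι f =ᵐ[μ] fun ω => ((A.indicator 1 ω : ℝ) : 𝕜)) {z : ℝ} (hz : -1 ≤ z) (n : ℕ) :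
    ‖mean ι (twistedOrbit U f z n)‖ = ∫ ω, (1 + z) ^ visits T A n ω ∂μ := by
  have := hC.isProbability
  have h := hC.integral_twistedOrbit_mul hU hA hf z n (fun _ => 1) (memLp_const 1)
  simp only [mul_one, prod_tilt] at h
  rw [mean, h, integral_ofReal, RCLike.norm_ofReal, abs_of_nonneg]
  exact integral_nonneg fun ω => pow_nonneg (by linarith) _

/-- The mean of a function against an indicator gains the measure of the set. This is what makes
the variance in the exponential bound proportional to `μ A`. -/
theorem PropertyC.norm_mean_mul_le (hC : PropertyC T ι) {A : Set Ω} (hA : MeasurableSet A) {f : F}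
    (hf : ι f =ᵐ[μ] fun ω => ((A.indicator 1 ω : ℝ) : 𝕜)) (r : F) :
    ‖mean ι (f * r)‖ ≤ μ.real A * ‖r‖ := by
  have := hC.isProbability
  have hi : Integrable (A.indicator fun _ => ‖r‖) μ := (integrable_const _).indicator hA
  refine (norm_integral_le_of_norm_le hi ?_).trans_eq ?_
  · rw [hC.map_mul]
    filter_upwards [hf, AEEqFun.coeFn_mul (ι f) (ι r), hC.ae_norm_le r] with ω h1 h2 h3
    rw [h2, Pi.mul_apply, h1]
    by_cases h : ω ∈ A <;> simp [h, h3]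
  · rw [integral_indicator hA]; simp

theorem mean_eq_measureReal {A : Set Ω} (hA : MeasurableSet A) {f : F}
    (hf : ι f =ᵐ[μ] fun ω => ((A.indicator 1 ω : ℝ) : 𝕜)) :
    mean ι f = (μ.real A : 𝕜) := by
  rw [mean, integral_congr_ae hf, integral_ofReal, integral_indicator_one hA]

/-- A uniform exponential moment bound for the visits to `A`: the second order term has the
factor `μ A`, and the constants depend on `A` only through the norm of its indicator. -/
theorem PropertyC.exists_integral_pow_visits_le (hC : PropertyC T ι) {K : ℝ} (hK : 0 < K) :
    ∃ z₀ C : ℝ, 0 < z₀ ∧ z₀ ≤ 1 / 2 ∧ 0 < C ∧ ∀ A : Set Ω, MeasurableSet A →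
      MemNormLE ι (A.indicator 1) K → ∀ z : ℝ, |z| ≤ z₀ → ∀ n : ℕ,
        ∫ ω, (1 + z) ^ visits T A n ω ∂μ ≤ Real.exp (n * μ.real A * (z + C * z ^ 2)) := by
  have := hC.isProbability
  obtain ⟨U, N, hU, hN, hN1, hUN⟩ := hC.exists_decomposition
  obtain ⟨W, M, ρ, hρ, hρ1, hM, hWge, hWle, hWN, hWadd, hWsmul⟩ := exists_adapted_norm N hN
  have hW0 : ∀ g, 0 ≤ W g := fun g => (norm_nonneg g).trans (hWge g)
  set Q : ℝ := M * K * (‖(1 : F)‖ + 1) with hQ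
  have hQ0 : 0 < Q := by positivity
  have hρ' : 0 < 1 - ρ := by linarith
  set C : ℝ := 2 * Q / (1 - ρ) with hCdef
  have hC0 : 0 < C := by positivity
  have hCQ : ρ * C + Q = C * ((1 + ρ) / 2) := by rw [hCdef]; field_simp; ring
  refine ⟨min ((1 - ρ) / 4) (1 / C), C, by positivity, ?_, hC0, ?_⟩
  · exact (min_le_left _ _).trans (by linarith)
  intro A hA hAF z hz n
  obtain ⟨f, hf, hfK⟩ := hAF
  have hz1 : |z| ≤ (1 - ρ) / 4 := hz.trans (min_le_left _ _)
  have hz2 : C * |z| ≤ 1 := by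
    have := hz.trans (min_le_right _ _)
    rw [le_div_iff₀ hC0] at this
    linarith
  have hzm : -1 ≤ z := by have := neg_abs_le z; linarith
  rw [← hC.norm_mean_twistedOrbit hU hA hf hzm n]
  set p := μ.real A
  have hp0 : 0 ≤ p := measureReal_nonneg
  have hp1 : p ≤ 1 := measureReal_le_one
  set h := twistedOrbit U f z with hh
  set a : ℕ → 𝕜 := fun n => mean ι (h n) with ha
  set r : ℕ → F := fun n => h n - a n • (1 : F) with hr
  have hhr : ∀ n, h n = a n • (1 : F) + r n := fun n => by simp [hr]
  have hsucc : ∀ n, h (n + 1) = U (h n + (z : 𝕜) • (f * h n)) := fun n => rfl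
  have hfh : ∀ n, f * h n = a n • f + f * r n := fun n => by
    conv_lhs => rw [hhr n]
    rw [mul_add, mul_smul_comm, mul_one]
  -- The scalar part `a` and the remainder `r` of the twisted orbit satisfy a coupled recursion.
  have harec : ∀ n, a (n + 1) = (1 + (z : 𝕜) * (p : 𝕜)) * a n + (z : 𝕜) * mean ι (f * r n) := by
    intro n
    simp only [ha]
    rw [hsucc, hC.mean_transfer hU, hC.mean_add, mean_smul, hfh, hC.mean_add, mean_smul,
      mean_eq_measureReal hA hf]
    simp only [ha]; ring
  have hrrec : ∀ n, r (n + 1) = N (r n) + (z : 𝕜) • N (f * h n) := by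
    intro n
    have h1 : a (n + 1) = mean ι (h n + (z : 𝕜) • (f * h n)) := by
      simp only [ha]; rw [hsucc, hC.mean_transfer hU]
    have h2 : N (h n) = N (r n) := by
      conv_lhs => rw [hhr n]
      simp [hN1]
    calc r (n + 1) = h (n + 1) - a (n + 1) • (1 : F) := rfl
      _ = N (h n + (z : 𝕜) • (f * h n)) := by rw [hsucc, hUN, h1]; simp
      _ = _ := by rw [map_add, map_smul, h2]
  have hcast : ‖(1 + (z : 𝕜) * (p : 𝕜))‖ = 1 + z * p := by
    have : (1 + (z : 𝕜) * (p : 𝕜)) = ((1 + z * p : ℝ) : 𝕜) := by push_cast; rfl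
    rw [this, RCLike.norm_ofReal, abs_of_nonneg]
    nlinarith
  have hzabs : ‖(z : 𝕜)‖ = |z| := RCLike.norm_ofReal z
  have herr : ∀ n, W (r n) ≤ C * |z| * ‖a n‖ →
      ‖(z : 𝕜) * mean ι (f * r n)‖ ≤ |z| * p * (C * |z| * ‖a n‖) := by
    intro n hn
    rw [norm_mul, hzabs, mul_assoc]
    gcongr
    exact (hC.norm_mean_mul_le hA hf _).trans (by gcongr; exact (hWge _).trans hn)
  -- The remainder stays small relative to the mean: `a` shrinks by a factor of at least
  -- `(1 + ρ) / 2` in a step, whereas `N` contracts by `ρ`.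
  have hmain : ∀ n, W (r n) ≤ C * |z| * ‖a n‖ := by
    intro n
    induction n with
    | zero =>
      have : r 0 = 0 := by
        simp [hr, ha, hh, twistedOrbit, hC.mean_one]
      rw [this]
      refine (hWle 0).trans ?_
      simp only [norm_zero, mul_zero]; positivity
    | succ n ih =>
      have hle : W (r n) ≤ ‖a n‖ := ih.trans (mul_le_of_le_one_left (norm_nonneg _) hz2)
      have hfhn : ‖f * h n‖ ≤ K * (‖(1 : F)‖ + 1) * ‖a n‖ := by
        have : ‖h n‖ ≤ (‖(1 : F)‖ + 1) * ‖a n‖ := by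
          rw [hhr n]
          refine (norm_add_le _ _).trans ?_
          rw [norm_smul]
          linarith [hWge (r n)]
        calc ‖f * h n‖ ≤ ‖f‖ * ‖h n‖ := norm_mul_le _ _
          _ ≤ K * ((‖(1 : F)‖ + 1) * ‖a n‖) := by gcongr
          _ = _ := by ring
      have hWN' : W (N (f * h n)) ≤ Q * ‖a n‖ := by
        refine (hWN _).trans ((mul_le_of_le_one_left (hW0 _) hρ1.le).trans ((hWle _).trans ?_))
        calc M * ‖f * h n‖ ≤ M * (K * (‖(1 : F)‖ + 1) * ‖a n‖) := by gcongr
          _ = _ := by rw [hQ]; ring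
      have hlow : (1 + ρ) / 2 * ‖a n‖ ≤ ‖a (n + 1)‖ := by
        have h1 := herr n ih
        have h2 : |z| * p * (C * |z| * ‖a n‖) ≤ |z| * 1 * (1 * ‖a n‖) := by gcongr
        have h3 : ‖(1 + (z : 𝕜) * (p : 𝕜)) * a n‖ ≤ ‖a (n + 1)‖ + ‖(z : 𝕜) * mean ι (f * r n)‖ := by
          have := norm_sub_le (a (n + 1)) ((z : 𝕜) * mean ι (f * r n))
          rwa [harec n, add_sub_cancel_right, ← harec n] at this
        rw [norm_mul, hcast] at h3
        have h4 : -|z| ≤ z * p := by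
          have h5 : |z * p| ≤ |z| := by
            rw [abs_mul, abs_of_nonneg hp0]; exact mul_le_of_le_one_right (abs_nonneg _) hp1
          exact (neg_le_neg h5).trans (neg_abs_le _)
        nlinarith [norm_nonneg (a n)]
      calc W (r (n + 1)) ≤ W (N (r n)) + |z| * W (N (f * h n)) := by
            rw [hrrec, ← hzabs, ← hWsmul]; exact hWadd _ _
        _ ≤ ρ * (C * |z| * ‖a n‖) + |z| * (Q * ‖a n‖) := by
            gcongr
            exact (hWN _).trans (by gcongr)
        _ = |z| * ‖a n‖ * (ρ * C + Q) := by ring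
        _ = C * |z| * ((1 + ρ) / 2 * ‖a n‖) := by rw [hCQ]; ring
        _ ≤ C * |z| * ‖a (n + 1)‖ := by gcongr
  have hstep : ∀ n, ‖a (n + 1)‖ ≤ Real.exp (p * (z + C * z ^ 2)) * ‖a n‖ := by
    intro n
    have h1 : ‖a (n + 1)‖ ≤ (1 + z * p) * ‖a n‖ + |z| * p * (C * |z| * ‖a n‖) := by
      rw [harec n]
      refine (norm_add_le _ _).trans (add_le_add ?_ (herr n (hmain n)))
      rw [norm_mul, hcast]
    refine h1.trans ?_
    have h2 : (1 + z * p) * ‖a n‖ + |z| * p * (C * |z| * ‖a n‖)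
        = (p * (z + C * z ^ 2) + 1) * ‖a n‖ := by
      rw [← sq_abs z]; ring
    rw [h2]
    gcongr
    exact Real.add_one_le_exp _
  change ‖a n‖ ≤ _
  induction n with
  | zero => simp [ha, hh, twistedOrbit, hC.mean_one]
  | succ n ih =>
    refine (hstep n).trans ?_
    calc _ ≤ Real.exp (p * (z + C * z ^ 2)) * Real.exp (n * p * (z + C * z ^ 2)) := by gcongr
      _ = _ := by rw [← Real.exp_add]; push_cast; ring_nf

theorem measurable_visits {T : Ω → Ω} (hT : Measurable T) {A : Set Ω} (hA : MeasurableSet A)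
    (n : ℕ) : Measurable (visits T A n) := by
  classical
  have : visits T A n = fun ω => ∑ i ∈ Finset.range n, if T^[i] ω ∈ A then 1 else 0 := by
    ext ω
    rw [visits, Finset.card_filter]
  rw [this]
  exact Finset.measurable_sum _ fun i _ =>
    Measurable.ite ((hT.iterate i) hA) measurable_const measurable_const

/-- Markov's inequality for the exponential moments of the number of visits. -/
theorem measureReal_le_exp_of_integral_pow_visits_le [IsProbabilityMeasure μ] (hT : Measurable T)
    {A : Set Ω} (hA : MeasurableSet A) {n : ℕ} {z s t : ℝ} (hz : -1 ≤ z) {S : Set Ω}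
    (hS : ∀ ω ∈ S, Real.exp s ≤ (1 + z) ^ visits T A n ω)
    (ht : ∫ ω, (1 + z) ^ visits T A n ω ∂μ ≤ Real.exp t) : μ.real S ≤ Real.exp (t - s) := by
  have hmeas : Measurable fun ω => (1 + z) ^ visits T A n ω :=
    (measurable_of_countable fun k : ℕ => (1 + z) ^ k).comp (measurable_visits hT hA n)
  have h0 : ∀ ω, 0 ≤ (1 + z) ^ visits T A n ω := fun ω => pow_nonneg (by linarith) _
  have hint : Integrable (fun ω => (1 + z) ^ visits T A n ω) μ := by
    refine Integrable.of_bound hmeas.aestronglyMeasurable ((1 + |z|) ^ n)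
      (Eventually.of_forall fun ω => ?_)
    rw [Real.norm_of_nonneg (h0 ω)]
    calc (1 + z) ^ visits T A n ω ≤ (1 + |z|) ^ visits T A n ω :=
          pow_le_pow_left₀ (by linarith) (by linarith [le_abs_self z]) _
      _ ≤ _ := pow_le_pow_right₀ (by linarith [abs_nonneg z]) (visits_le T A n ω)
  have h1 := mul_meas_ge_le_integral_of_nonneg (Eventually.of_forall h0) hint (Real.exp s)
  have h2 : μ.real S ≤ μ.real {ω | Real.exp s ≤ (1 + z) ^ visits T A n ω} :=
    measureReal_mono hS
  rw [Real.exp_sub, le_div_iff₀ (Real.exp_pos s)]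
  nlinarith [Real.exp_pos s]

theorem sub_two_mul_sq_le_log_one_add {z : ℝ} (hz : |z| ≤ 1 / 2) :
    z - 2 * z ^ 2 ≤ Real.log (1 + z) := by
  have hz' : 1 / 2 ≤ 1 + z := by have := neg_abs_le z; linarith
  refine le_trans ?_ (Real.one_sub_inv_le_log_of_pos (by linarith))
  have : 1 - (1 + z)⁻¹ = z - z ^ 2 * (1 + z)⁻¹ := by field_simp; ring
  rw [this]
  have h2 : (1 + z)⁻¹ ≤ 2 := by
    rw [inv_le_comm₀ (by linarith) two_pos]; linarith
  nlinarith [sq_nonneg z]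

/-- A uniform exponential law of large numbers for the visits to sets of bounded norm; the
exponent is proportional to the expected number `n μ(A)` of visits. -/
theorem PropertyC.exists_measureReal_visits_le (hC : PropertyC T ι) {K δ : ℝ} (hK : 0 < K)
    (hδ : 0 < δ) (hδ1 : δ < 1) :
    ∃ c : ℝ, 0 < c ∧ ∀ A : Set Ω, MeasurableSet A → MemNormLE ι (A.indicator 1) K → ∀ n : ℕ,
      μ.real {ω | δ * (n * μ.real A) < |(visits T A n ω : ℝ) - n * μ.real A|} ≤
        2 * Real.exp (-(c * (n * μ.real A))) := by
  have := hC.isProbability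
  obtain ⟨z₀, C, hz₀, hz₀', hC0, hmgf⟩ := hC.exists_integral_pow_visits_le hK
  -- With this `z` the second order terms take at most half of the gain `δ * z`.
  set z : ℝ := min z₀ (δ / (2 * (4 + C))) with hz
  have hzpos : 0 < z := by positivity
  have hzz₀ : z ≤ z₀ := min_le_left _ _
  have hzhalf : z ≤ 1 / 2 := hzz₀.trans hz₀'
  have hzδ : z * (4 + C) ≤ δ / 2 := by
    have h : z ≤ δ / (2 * (4 + C)) := min_le_right _ _
    rw [le_div_iff₀ (by positivity)] at h
    linarith
  have hsq : (4 + C) * z ^ 2 ≤ δ * z / 2 := by nlinarith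
  refine ⟨δ * z / 2, by positivity, fun A hA hAF n => ?_⟩
  set y : ℝ := n * μ.real A with hy
  have hy0 : 0 ≤ y := by positivity
  have hup : μ.real {ω | (1 + δ) * y ≤ visits T A n ω} ≤ Real.exp (-(δ * z / 2 * y)) := by
    have hlog := sub_two_mul_sq_le_log_one_add (z := z) (by rwa [abs_of_pos hzpos])
    refine (measureReal_le_exp_of_integral_pow_visits_le hC.invariant.measurable hA (n := n)
      (z := z) (s := (1 + δ) * y * (z - 2 * z ^ 2)) (by linarith) (fun ω hω => ?_)
      (hmgf A hA hAF z (by rwa [abs_of_pos hzpos]) n)).trans (Real.exp_le_exp.2 ?_)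
    · rw [← Real.exp_log (show 0 < 1 + z by linarith), ← Real.exp_nat_mul]
      refine Real.exp_le_exp.2 (mul_le_mul hω hlog ?_ (by positivity))
      nlinarith
    · rw [← hy]
      have : 2 * (1 + δ) * z ^ 2 ≤ 4 * z ^ 2 := by nlinarith [sq_nonneg z]
      nlinarith
  have hlo : μ.real {ω | (visits T A n ω : ℝ) ≤ (1 - δ) * y} ≤ Real.exp (-(δ * z / 2 * y)) := by
    have hlog := sub_two_mul_sq_le_log_one_add (z := -z) (by rwa [abs_neg, abs_of_pos hzpos])
    have hlog0 : Real.log (1 + -z) ≤ 0 := Real.log_nonpos (by linarith) (by linarith)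
    refine (measureReal_le_exp_of_integral_pow_visits_le hC.invariant.measurable hA (n := n)
      (z := -z) (s := (1 - δ) * y * (-z - 2 * z ^ 2)) (by linarith) (fun ω hω => ?_)
      (hmgf A hA hAF (-z) (by rwa [abs_neg, abs_of_pos hzpos]) n)).trans (Real.exp_le_exp.2 ?_)
    · rw [← Real.exp_log (show 0 < 1 + -z by linarith), ← Real.exp_nat_mul]
      refine Real.exp_le_exp.2 ?_
      calc (1 - δ) * y * (-z - 2 * z ^ 2) ≤ (1 - δ) * y * Real.log (1 + -z) := by
            have : 0 ≤ 1 - δ := by linarith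
            gcongr
            linarith [hlog]
        _ ≤ _ := mul_le_mul_of_nonpos_right hω hlog0
    · rw [← hy]
      have : 2 * (1 - δ) * z ^ 2 ≤ 4 * z ^ 2 := by nlinarith [sq_nonneg z]
      nlinarith
  have hsub : {ω | δ * y < |(visits T A n ω : ℝ) - y|} ⊆
      {ω | (1 + δ) * y ≤ visits T A n ω} ∪ {ω | (visits T A n ω : ℝ) ≤ (1 - δ) * y} := by
    intro ω hω
    rcases lt_abs.1 (show δ * y < |(visits T A n ω : ℝ) - y| from hω) with h | h
    · left; rw [Set.mem_ofPred_eq]; linarith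
    · right; rw [Set.mem_ofPred_eq]; linarith
  calc _ ≤ _ := measureReal_mono hsub
    _ ≤ _ := measureReal_union_le _ _
    _ ≤ _ := by linarith

end mgf

/-! ### Trimmed sums and visits to level sets -/

section layers

theorem card_filter_fin_le_and_lt {n N : ℕ} (b : ℕ) (hN : N ≤ n) :
    ((Finset.univ : Finset (Fin n)).filter fun k : Fin n => b ≤ (k : ℕ) ∧ (k : ℕ) < N).card
      = N - b := by
  rw [Finset.card_filter, Fin.sum_univ_eq_sum_range (fun k => if b ≤ k ∧ k < N then 1 else 0) n,
    ← Finset.card_filter, ← Nat.card_Ico]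
  congr 1
  ext k
  simp only [Finset.mem_filter, Finset.mem_range, Finset.mem_Ico]
  omega

theorem lt_card_filter_iff {n : ℕ} (p : Fin n → Prop) [DecidablePred p]
    (hp : ∀ k l, k ≤ l → p l → p k) (k : Fin n) :
    (k : ℕ) < (Finset.univ.filter p).card ↔ p k := by
  constructor
  · intro h
    by_contra hk
    have : (Finset.univ.filter p) ⊆ Finset.Iio k := fun l hl => by
      rw [Finset.mem_Iio]
      by_contra hkl
      exact hk (hp k l (not_lt.1 hkl) (Finset.mem_filter.1 hl).2)
    have := Finset.card_le_card this
    rw [Fin.card_Iio] at this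
    omega
  · intro h
    have : Finset.Iic k ⊆ Finset.univ.filter p := fun l hl =>
      Finset.mem_filter.2 ⟨Finset.mem_univ _, hp l k (Finset.mem_Iic.1 hl) h⟩
    have := Finset.card_le_card this
    rw [Fin.card_Iic] at this
    omega

variable {Ω : Type*}

/-- Of the terms that survive the trimming, the number of those exceeding `t` is the number of
all terms exceeding `t`, minus `b` (truncated at zero). -/
theorem sum_decreasingOrder_indicator (T : Ω → Ω) (χ : Ω → ℝ) (n b : ℕ) (ω : Ω) (t : ℝ) :
    (∑ k ∈ (Finset.univ : Finset (Fin n)).filter fun k : Fin n => b ≤ (k : ℕ),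
      if t < χ (T^[decreasingOrder T χ n ω k] ω) then (1 : ℝ) else 0) =
      ((visits T {ω | t < χ ω} n ω - b : ℕ) : ℝ) := by
  classical
  set p : Fin n → Prop := fun k => t < χ (T^[decreasingOrder T χ n ω k] ω) with hp
  have hcard : (Finset.univ.filter p).card = visits T {ω | t < χ ω} n ω := by
    have h1 : (Finset.univ.filter p).card = ∑ k : Fin n, if p k then 1 else 0 :=
      Finset.card_filter _ _
    rw [h1]
    change (∑ k : Fin n, if t < χ (T^[decreasingOrder T χ n ω k] ω) then 1 else 0) = _
    rw [Equiv.sum_comp (decreasingOrder T χ n ω)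
      (fun i : Fin n => if t < χ (T^[i] ω) then 1 else 0),
      Fin.sum_univ_eq_sum_range (fun i => if t < χ (T^[i] ω) then 1 else 0) n,
      ← Finset.card_filter, visits]
    congr!
  have hanti := antitone_decreasingOrder T χ n ω
  have hiff := lt_card_filter_iff p fun k l hkl hl => lt_of_lt_of_le hl (hanti hkl)
  rw [Finset.sum_boole, Finset.filter_filter, ← hcard,
    ← card_filter_fin_le_and_lt b (card_finset_fin_le _)]
  congr 2
  ext k
  simp only [Finset.mem_filter, Finset.mem_univ, true_and]
  rw [hiff]

/-- The layers of a number that, when it exceeds `η`, is a power of `η`. -/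
theorem min_pow_eq_min_add_sum {η x : ℝ} (hη : 1 < η) (hx : η < x → ∃ k : ℕ, x = η ^ k) (K : ℕ) :
    min x (η ^ (K + 1)) = min x η +
      ∑ j ∈ Finset.range K, (η - 1) * η ^ (j + 1) * if η ^ (j + 1) < x then 1 else 0 := by
  induction K with
  | zero => simp
  | succ K ih =>
    rw [Finset.sum_range_succ, ← add_assoc, ← ih]
    by_cases h : η ^ (K + 1) < x
    · obtain ⟨k, rfl⟩ := hx (lt_of_le_of_lt (le_self_pow₀ hη.le (by omega)) h)
      have hk : K + 1 < k := (pow_lt_pow_iff_right₀ hη).1 h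
      rw [min_eq_right h.le, min_eq_right (pow_le_pow_right₀ hη.le (show K + 1 + 1 ≤ k from hk)),
        if_pos h]
      ring
    · have h' : x ≤ η ^ (K + 1) := not_lt.1 h
      rw [min_eq_left h', min_eq_left (h'.trans (pow_le_pow_right₀ hη.le (by omega))), if_neg h]
      ring

theorem visits_eq_zero {T : Ω → Ω} {A : Set Ω} {n : ℕ} {ω : Ω} (h : ∀ i < n, T^[i] ω ∉ A) :
    visits T A n ω = 0 := by
  classical
  rw [visits, Finset.card_eq_zero, Finset.filter_eq_empty_iff]
  exact fun i hi => h i (Finset.mem_range.1 hi)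

/-- The trimmed sum in terms of the numbers of visits to the level sets, up to the bounded part
of the observable. -/
theorem exists_hasSum_visits (T : Ω → Ω) (χ : Ω → ℝ) {η : ℝ} (hη : 1 < η) (h0 : ∀ ω, 0 ≤ χ ω)
    (ω : Ω) (hω : ∀ i, η < χ (T^[i] ω) → ∃ k : ℕ, χ (T^[i] ω) = η ^ k) (n b : ℕ) :
    ∃ e : ℝ, 0 ≤ e ∧ e ≤ n * η ∧
      HasSum (fun j : ℕ => (η - 1) * η ^ (j + 1) *
        ((visits T {ω | η ^ (j + 1) < χ ω} n ω - b : ℕ) : ℝ)) (trimmedSum T χ n b ω - e) := by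
  set s := (Finset.univ : Finset (Fin n)).filter fun k : Fin n => b ≤ (k : ℕ)
  set x : Fin n → ℝ := fun k => χ (T^[decreasingOrder T χ n ω k] ω) with hx
  obtain ⟨K, hK⟩ : ∃ K : ℕ, ∀ i < n, χ (T^[i] ω) ≤ η ^ (K + 1) := by
    obtain ⟨K, hK⟩ := pow_unbounded_of_one_lt (∑ i ∈ Finset.range n, χ (T^[i] ω)) hη
    refine ⟨K, fun i hi => ?_⟩
    calc χ (T^[i] ω) ≤ ∑ i ∈ Finset.range n, χ (T^[i] ω) :=
          Finset.single_le_sum (f := fun i => χ (T^[i] ω)) (fun i _ => h0 _) (Finset.mem_range.2 hi)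
      _ ≤ η ^ K := hK.le
      _ ≤ _ := pow_le_pow_right₀ hη.le (by omega)
  refine ⟨∑ k ∈ s, min (x k) η, Finset.sum_nonneg fun k _ => le_min (h0 _) (by linarith), ?_, ?_⟩
  · calc ∑ k ∈ s, min (x k) η ≤ ∑ k ∈ s, η := Finset.sum_le_sum fun k _ => min_le_right _ _
      _ = s.card * η := by rw [Finset.sum_const, nsmul_eq_mul]
      _ ≤ n * η := by
        gcongr
        exact card_finset_fin_le s
  · have key : trimmedSum T χ n b ω - ∑ k ∈ s, min (x k) η = ∑ j ∈ Finset.range K,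
        (η - 1) * η ^ (j + 1) * ((visits T {ω | η ^ (j + 1) < χ ω} n ω - b : ℕ) : ℝ) := by
      simp only [← sum_decreasingOrder_indicator]
      change ∑ k ∈ s, x k - _ = _
      rw [← Finset.sum_sub_distrib]
      simp only [Finset.mul_sum]
      rw [Finset.sum_comm]
      refine Finset.sum_congr rfl fun k _ => ?_
      rw [sub_eq_iff_eq_add', ← min_pow_eq_min_add_sum hη (hω _) K]
      exact (min_eq_left (hK _ (Fin.is_lt _))).symm
    rw [key]
    refine hasSum_sum_of_ne_finset_zero fun j hj => ?_
    rw [visits_eq_zero]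
    · simp
    · intro i hi
      have hj : K ≤ j := by simpa using hj
      exact not_lt.2 ((hK i hi).trans (pow_le_pow_right₀ hη.le (by omega)))

end layers

/-! ### The normalizing constants -/

section normalizer

/-- The normalizing constant of the trimmed sum: the sum over the levels `η ^ (j + 1)` of the
height of the layer above it times the excess over `b` of the expected number `n c q ^ j` of
terms above that level. -/
noncomputable def normalizer (q η c : ℝ) (n b : ℕ) : ℝ :=
  ∑' j : ℕ, (η - 1) * η ^ (j + 1) * max (n * (c * q ^ j) - b) 0

variable {q η c : ℝ}

theorem summable_normalizer (hq0 : 0 < q) (hq1 : q < 1) (n : ℕ) {b : ℕ}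
    (hb : 0 < b) :
    Summable fun j : ℕ => (η - 1) * η ^ (j + 1) * max (n * (c * q ^ j) - b) 0 := by
  have h1 : Tendsto (fun j : ℕ => n * (c * q ^ j)) atTop (𝓝 0) := by
    simpa using ((tendsto_pow_atTop_nhds_zero_of_lt_one hq0.le hq1).const_mul c).const_mul (n : ℝ)
  obtain ⟨K, hK⟩ := eventually_atTop.1 (h1.eventually_lt_const (Nat.cast_pos.2 hb))
  refine summable_of_ne_finset_zero (s := Finset.range K) fun j hj => ?_
  have hj : K ≤ j := by simpa using hj
  rw [max_eq_right (by linarith [hK j hj]), mul_zero]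

theorem normalizer_term_nonneg (hη : 1 < η) (n b j : ℕ) :
    0 ≤ (η - 1) * η ^ (j + 1) * max (n * (c * q ^ j) - b) 0 := by
  have : 0 ≤ η - 1 := by linarith
  positivity

/-- The normalizing constants grow faster than `n`, because `q * η > 1`. -/
theorem eventually_mul_le_normalizer (hq0 : 0 < q) (hq1 : q < 1) (hc : 0 < c) (hη : 1 < η)
    (hqη : 1 < q * η) {b : ℕ → ℕ} (hb : Tendsto b atTop atTop)
    (hbn : (fun n => (b n : ℝ)) =o[atTop] fun n => (n : ℝ)) (M : ℝ) :
    ∀ᶠ n : ℕ in atTop, M * n ≤ normalizer q η c n (b n) := by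
  have hη0 : 0 < η - 1 := by linarith
  have h1 : Tendsto (fun j : ℕ => (η - 1) * η * c * (q * η) ^ j) atTop atTop :=
    (tendsto_pow_atTop_atTop_of_one_lt hqη).const_mul_atTop (by positivity)
  obtain ⟨j, hj⟩ := (h1.eventually_ge_atTop (M + 1)).exists
  have hv : 0 < (η - 1) * η ^ (j + 1) := by positivity
  filter_upwards [hbn.bound (inv_pos.2 hv), hb.eventually_gt_atTop 0] with n hn hb0
  have h2 := (summable_normalizer (η := η) (c := c) hq0 hq1 n hb0).le_tsum j
    fun i _ => normalizer_term_nonneg hη n (b n) i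
  refine le_trans ?_ h2
  rw [Real.norm_natCast, Real.norm_natCast, inv_mul_eq_div, le_div_iff₀ hv] at hn
  calc M * n ≤ ((η - 1) * η * c * (q * η) ^ j - 1) * n := by gcongr; linarith
    _ ≤ (η - 1) * η ^ (j + 1) * (n * (c * q ^ j) - b n) := by
      have : (η - 1) * η ^ (j + 1) * (n * (c * q ^ j) - b n)
        = (η - 1) * η * c * (q * η) ^ j * n - b n * ((η - 1) * η ^ (j + 1)) := by
        rw [mul_pow]; ring
      linarith
    _ ≤ _ := by gcongr; exact le_max_left _ _

theorem natCast_sub_eq_max (a b : ℕ) : ((a - b : ℕ) : ℝ) = max ((a : ℝ) - b) 0 := by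
  rcases le_total b a with h | h
  · rw [Nat.cast_sub h, max_eq_left]
    exact sub_nonneg.2 (Nat.cast_le.2 h)
  · rw [Nat.sub_eq_zero_of_le h, max_eq_right]
    · simp
    · exact sub_nonpos.2 (Nat.cast_le.2 h)

/-- If the counts `N j` agree with their expectations `n c q ^ j` up to a relative error `δ` on all
levels where the expectation is at least `q b / 2`, the trimmed sum over the levels agrees with
the normalizing constant up to a relative error proportional to `δ`. The levels with expectation
near `b` may be lost, but their weight is comparable to that of the levels lying `J` steps below. -/
theorem abs_sub_normalizer_le (hq0 : 0 < q) (hq1 : q < 1) (hc : 0 < c) (hη : 1 < η)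
    {J : ℕ} (hJ : q ^ J ≤ 1 / 4) {n b : ℕ} (hb0 : 0 < b) (hbn : 2 * b ≤ n * (c * q ^ J))
    {N : ℕ → ℕ} (hN : Antitone N) {δ : ℝ} (hδ0 : 0 ≤ δ) (hδ1 : δ ≤ 1)
    (h : ∀ j, q / 2 * b ≤ n * (c * q ^ j) → |(N j : ℝ) - n * (c * q ^ j)| ≤ δ * (n * (c * q ^ j)))
    {s : ℝ} (hs : HasSum (fun j : ℕ => (η - 1) * η ^ (j + 1) * ((N j - b : ℕ) : ℝ)) s) :
    |s - normalizer q η c n b| ≤ δ * (2 * (1 + (q * η) ^ J)) * normalizer q η c n b := by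
  have hη0 : 0 < η - 1 := by linarith
  have hb : (0 : ℝ) < b := Nat.cast_pos.2 hb0
  set t : ℕ → ℝ := fun j => (η - 1) * η ^ (j + 1) * max (n * (c * q ^ j) - b) 0 with ht
  have ht0 : ∀ j, 0 ≤ t j := normalizer_term_nonneg hη n b
  have hts : HasSum t (normalizer q η c n b) := (summable_normalizer hq0 hq1 n hb0).hasSum
  -- `t` shifted by `J` levels: it bounds the levels whose expectation lies near `b`.
  set t' : ℕ → ℝ := fun j => if j < J then 0 else t (j - J) with ht'
  have ht'0 : ∀ j, 0 ≤ t' j := fun j => by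
    simp only [ht']; split_ifs
    · exact le_rfl
    · exact ht0 _
  have hts' : HasSum t' (normalizer q η c n b) := by
    refine (Function.Injective.hasSum_iff (f := t') (add_left_injective J) fun j hj => ?_).1 ?_
    · have : j < J := by
        by_contra h'
        exact hj ⟨j - J, Nat.sub_add_cancel (not_lt.1 h')⟩
      simp [ht', this]
    · convert hts using 1
      ext j
      simp [ht']
  have hle : ∀ i j : ℕ, i ≤ j → n * (c * q ^ j) ≤ n * (c * q ^ i) := fun i j hij => by
    have := pow_le_pow_of_le_one hq0.le hq1.le hij
    gcongr
  have hbig : ∀ j, 2 * b ≤ n * (c * q ^ j) →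
      (η - 1) * η ^ (j + 1) * (n * (c * q ^ j)) ≤ 2 * t j := by
    intro j hj
    have hmax : n * (c * q ^ j) ≤ 2 * max (n * (c * q ^ j) - (b : ℝ)) 0 := by
      linarith [le_max_left (n * (c * q ^ j) - (b : ℝ)) 0]
    calc (η - 1) * η ^ (j + 1) * (n * (c * q ^ j))
        ≤ (η - 1) * η ^ (j + 1) * (2 * max (n * (c * q ^ j) - b) 0) := by
          gcongr
      _ = 2 * t j := by simp only [ht]; ring
  have hterm : ∀ j, ‖(η - 1) * η ^ (j + 1) * ((N j - b : ℕ) : ℝ) - t j‖ ≤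
      δ * (2 * t j) + δ * (2 * (q * η) ^ J * t' j) := by
    intro j
    have hqη0 : 0 ≤ (q * η) ^ J := by positivity
    -- Levels with fewer than `b / 2` expected visits are removed by the trimming.
    rcases le_or_gt (b / 2 : ℝ) (n * (c * q ^ j)) with hj | hj
    · have h1 := h j (by nlinarith)
      have h2 : ‖(η - 1) * η ^ (j + 1) * ((N j - b : ℕ) : ℝ) - t j‖ ≤
          δ * ((η - 1) * η ^ (j + 1) * (n * (c * q ^ j))) := by
        simp only [ht]
        rw [← mul_sub, natCast_sub_eq_max, norm_mul, Real.norm_of_nonneg (by positivity),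
          Real.norm_eq_abs]
        have h3 := abs_max_sub_max_le_abs ((N j : ℝ) - b) (n * (c * q ^ j) - b) 0
        rw [sub_sub_sub_cancel_right] at h3
        calc _ ≤ (η - 1) * η ^ (j + 1) * (δ * (n * (c * q ^ j))) := by
              gcongr; exact h3.trans h1
          _ = _ := by ring
      refine h2.trans ?_
      rw [← mul_add]
      gcongr
      by_cases hjJ : j < J
      · have := hbig j (hbn.trans (hle _ _ hjJ.le))
        nlinarith [ht'0 j]
      · obtain ⟨i, rfl⟩ := Nat.exists_eq_add_of_le' (not_lt.1 hjJ)
        have e1 : t' (i + J) = t i := by simp [ht']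
        have e2 : n * (c * q ^ (i + J)) = n * (c * q ^ i) * q ^ J := by ring
        have h3 : 2 * b ≤ n * (c * q ^ i) := by
          rw [e2] at hj
          have : 0 ≤ n * (c * q ^ i) := by positivity
          nlinarith
        have h4 := hbig i h3
        calc (η - 1) * η ^ (i + J + 1) * (n * (c * q ^ (i + J)))
            = (q * η) ^ J * ((η - 1) * η ^ (i + 1) * (n * (c * q ^ i))) := by rw [mul_pow]; ring
          _ ≤ (q * η) ^ J * (2 * t i) := by gcongr
          _ ≤ _ := by rw [e1]; nlinarith [ht0 (i + J)]
    · have hex : ∃ j : ℕ, n * (c * q ^ j) < (b / 2 : ℝ) := ⟨j, hj⟩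
      classical
      -- The first such level is still controlled, and has at most `b` visits.
      set i := Nat.find hex with hi
      have hi1 : n * (c * q ^ i) < (b / 2 : ℝ) := Nat.find_spec hex
      have hi0 : i ≠ 0 := by
        intro h0
        rw [h0] at hi1
        linarith [hle 0 J (Nat.zero_le _)]
      obtain ⟨l, hl⟩ := Nat.exists_eq_succ_of_ne_zero hi0
      have hl1 : (b / 2 : ℝ) ≤ n * (c * q ^ l) := by
        have := Nat.find_min hex (m := l) (by omega)
        linarith
      have e1 : n * (c * q ^ i) = n * (c * q ^ l) * q := by rw [hl, Nat.succ_eq_add_one]; ring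
      have h1 := (abs_le.1 (h i (by rw [e1]; nlinarith))).2
      have h2 : (N i : ℝ) ≤ b := by
        have : 0 ≤ n * (c * q ^ i) := by positivity
        nlinarith
      have h3 : N j ≤ b := (hN (Nat.find_min' hex hj)).trans (Nat.cast_le.1 h2)
      have e2 : t j = 0 := by
        simp only [ht]
        rw [max_eq_right (by linarith), mul_zero]
      rw [Nat.sub_eq_zero_of_le h3, e2]
      have := ht'0 j
      simp only [Nat.cast_zero, mul_zero, sub_zero, norm_zero, zero_add]
      positivity
  have hsum := ((hts.mul_left 2).mul_left δ).add ((hts'.mul_left (2 * (q * η) ^ J)).mul_left δ)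
  have := (hs.sub hts).norm_le_of_bounded hsum hterm
  rw [Real.norm_eq_abs] at this
  refine this.trans_eq ?_
  ring

end normalizer

/-! ### A strong law of large numbers, uniform over the levels -/

section levels

/-- A geometric sum whose terms are at most one is bounded independently of its length. -/
theorem sum_range_inv_geometric_le {q x : ℝ} (hq0 : 0 < q) (hq1 : q < 1) (hx : 0 < x) {K : ℕ}
    (hK : ∀ j < K, 1 ≤ x * q ^ j) : ∑ j ∈ Finset.range K, (x * q ^ j)⁻¹ ≤ (1 - q)⁻¹ := by
  have hq' : 0 < 1 - q := by linarith
  rcases K with _ | K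
  · simpa using hq'.le
  have h1 : ∀ k, ∑ j ∈ Finset.range (k + 1), (x * q ^ j)⁻¹ ≤ (1 - q)⁻¹ * (x * q ^ k)⁻¹ := by
    intro k
    induction k with
    | zero =>
      rw [Finset.sum_range_one]
      exact le_mul_of_one_le_left (by positivity) ((one_le_inv₀ hq').2 (by linarith))
    | succ k ih =>
      rw [Finset.sum_range_succ]
      refine (add_le_add_left ih _).trans_eq ?_
      field_simp
      ring
  refine (h1 K).trans (mul_le_of_le_one_right (by positivity) ?_)
  exact inv_le_one_of_one_le₀ (hK K (Nat.lt_succ_self K))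

theorem visits_mono {Ω : Type*} (T : Ω → Ω) (A : Set Ω) (ω : Ω) :
    Monotone fun n => visits T A n ω := fun m n hmn => by
  classical
  exact Finset.card_le_card (Finset.filter_subset_filter _ (Finset.range_mono hmn))

/-- The points of the grid by which the block `[e ^ m, e ^ (m + 1)]` is divided into `I` parts. -/
noncomputable def grid (I m i : ℕ) : ℕ := ⌊Real.exp (m + i / I)⌋₊

theorem exp_div_two_le_grid (I m i : ℕ) : Real.exp m / 2 ≤ grid I m i := by
  have h0 : (0 : ℝ) ≤ i / I := by positivity
  have h1 : Real.exp m ≤ Real.exp (m + i / I) := Real.exp_le_exp.2 (by linarith)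
  have h2 : (1 : ℝ) ≤ Real.exp m := Real.one_le_exp (Nat.cast_nonneg m)
  have h3 : (1 : ℝ) ≤ grid I m i := by
    rw [← Nat.cast_one, Nat.cast_le]
    exact Nat.le_floor (by simpa using h2.trans h1)
  have h4 : Real.exp (m + i / I) < grid I m i + 1 := Nat.lt_floor_add_one _
  linarith

/-- Every large `n` lies between two neighbouring grid points of its block, which differ from `n`
by a small factor. -/
theorem eventually_exists_grid {θ : ℝ} (hθ : 0 < θ) (hθ1 : θ ≤ 1 / 2) {I : ℕ}
    (hI : 1 ≤ θ * I) :
    ∀ᶠ n : ℕ in atTop, ∃ i < I, grid I ⌊Real.log n⌋₊ i ≤ n ∧ n ≤ grid I ⌊Real.log n⌋₊ (i + 1) ∧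
      (1 - 2 * θ) * n ≤ grid I ⌊Real.log n⌋₊ i ∧
      (grid I ⌊Real.log n⌋₊ (i + 1) : ℝ) ≤ (1 + 2 * θ) * n := by
  have hI0 : (0 : ℝ) < I := by
    rcases Nat.eq_zero_or_pos I with rfl | h
    · norm_num at hI
    · exact Nat.cast_pos.2 h
  have hIθ : 1 / (I : ℝ) ≤ θ := by rw [div_le_iff₀ hI0]; exact hI
  have hlim : Tendsto (fun n : ℕ => θ * (n : ℝ)) atTop atTop :=
    tendsto_natCast_atTop_atTop.const_mul_atTop hθ
  filter_upwards [eventually_ge_atTop 1, hlim.eventually_ge_atTop 1] with n hn hn1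
  have hn0 : (0 : ℝ) < n := by exact_mod_cast hn
  have hlog0 : 0 ≤ Real.log n := Real.log_natCast_nonneg n
  set m := ⌊Real.log n⌋₊ with hm
  have hm1 : (m : ℝ) ≤ Real.log n := Nat.floor_le hlog0
  have hm2 : Real.log n < m + 1 := Nat.lt_floor_add_one _
  have hu0 : 0 ≤ (Real.log n - m) * I := mul_nonneg (by linarith) hI0.le
  set i := ⌊(Real.log n - m) * I⌋₊ with hi
  have hi1 : (i : ℝ) ≤ (Real.log n - m) * I := Nat.floor_le hu0
  have hi2 : (Real.log n - m) * I < i + 1 := Nat.lt_floor_add_one _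
  have hiI : i < I := by
    rw [hi, Nat.floor_lt hu0]
    nlinarith
  have hlo : m + i / I ≤ Real.log n := by
    have : (i : ℝ) / I ≤ Real.log n - m := by rwa [div_le_iff₀ hI0]
    linarith
  have hhi : Real.log n ≤ m + (i + 1 : ℕ) / I := by
    have : Real.log n - m ≤ ((i + 1 : ℕ) : ℝ) / I := by
      rw [le_div_iff₀ hI0]; push_cast; exact hi2.le
    linarith
  have hstep : (m : ℝ) + (i + 1 : ℕ) / I = m + i / I + 1 / I := by push_cast; ring
  have e1 : Real.exp (m + i / I) ≤ n := by
    rw [← Real.exp_log hn0]; exact Real.exp_le_exp.2 hlo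
  have e2 : (n : ℝ) ≤ Real.exp (m + (i + 1 : ℕ) / I) := by
    conv_lhs => rw [← Real.exp_log hn0]
    exact Real.exp_le_exp.2 hhi
  have hexp : 1 - θ ≤ Real.exp (-(1 / I)) :=
    le_trans (by linarith) (Real.one_sub_le_exp_neg _)
  have hexp2 : Real.exp (1 / I) ≤ 1 + 2 * θ := by
    have h1 : Real.exp (1 / I) * (1 - θ) ≤ 1 := by
      calc _ ≤ Real.exp (1 / I) * Real.exp (-(1 / I)) := by gcongr
        _ = 1 := by rw [← Real.exp_add]; simp
    have h2 : 1 ≤ (1 + 2 * θ) * (1 - θ) := by nlinarith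
    exact le_of_mul_le_mul_right (h1.trans h2) (by linarith)
  refine ⟨i, hiI, ?_, Nat.le_floor e2, ?_, ?_⟩
  · exact_mod_cast (Nat.floor_le (Real.exp_pos _).le).trans e1
  · have h1 : Real.exp (m + i / I) < grid I m i + 1 := Nat.lt_floor_add_one _
    have h2 : (1 - θ) * n ≤ Real.exp (m + i / I) := by
      calc (1 - θ) * n ≤ Real.exp (-(1 / I)) * Real.exp (m + (i + 1 : ℕ) / I) := by
            gcongr
        _ = _ := by rw [← Real.exp_add, hstep]; congr 1; ring
    linarith
  · have h1 : (grid I m (i + 1) : ℝ) ≤ Real.exp (m + (i + 1 : ℕ) / I) :=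
      Nat.floor_le (Real.exp_pos _).le
    refine h1.trans ?_
    rw [hstep, Real.exp_add, mul_comm]
    gcongr

variable {Ω 𝕜 F : Type*} [MeasurableSpace Ω] [RCLike 𝕜] {μ : Measure Ω}
  [NormedCommRing F] [NormedAlgebra 𝕜 F] {T : Ω → Ω} {ι : F →ₗ[𝕜] (Ω →ₘ[μ] 𝕜)}

/-- A strong law of large numbers for the visits to the sets of a geometrically shrinking
sequence, uniform over all sets whose expected number of visits is at least `κ b n`. -/
theorem PropertyC.ae_eventually_visits (hC : PropertyC T ι) {K : ℝ} (hK : 0 < K) {A : ℕ → Set Ω}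
    (hA : ∀ j, MeasurableSet (A j)) (hAF : ∀ j, MemNormLE ι ((A j).indicator 1) K) {c q : ℝ}
    (hc : 0 < c) (hq0 : 0 < q) (hq1 : q < 1) (hAμ : ∀ j, μ.real (A j) = c * q ^ j)
    {b : ℕ → ℕ} (hb : Tendsto b atTop atTop) {ψ : ℕ → ℝ} (hψ : ψ ∈ Psi)
    (hbψ : Tendsto (fun n : ℕ => (b n : ℝ) / Real.log (ψ ⌊Real.log n⌋₊)) atTop atTop)
    {κ δ : ℝ} (hκ : 0 < κ) (hδ0 : 0 < δ) (hδ1 : δ < 1) :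
    ∀ᵐ ω ∂μ, ∀ᶠ n : ℕ in atTop, ∀ j, κ * b n ≤ n * (c * q ^ j) →
      |(visits T (A j) n ω : ℝ) - n * (c * q ^ j)| ≤ δ * (n * (c * q ^ j)) := by
  have := hC.isProbability
  set θ : ℝ := δ / 5 with hθ
  have hθ0 : 0 < θ := by positivity
  obtain ⟨a, ha, hconc⟩ := hC.exists_measureReal_visits_le hK hθ0 (by rw [hθ]; linarith)
  obtain ⟨I, hI⟩ := exists_nat_ge (1 / θ)
  have hI' : 1 ≤ θ * I := by rw [div_le_iff₀ hθ0] at hI; linarith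
  set t : ℕ → ℝ := fun m => max (4 / a * Real.log (ψ m)) 1 with ht
  -- The levels that have to be controlled on the block `m` are those below `k m`.
  have hfin : ∀ m : ℕ, ∃ k : ℕ, ∀ j, j < k ↔ t m ≤ Real.exp m * c * q ^ j := by
    intro m
    have h1 : Tendsto (fun j : ℕ => Real.exp m * c * q ^ j) atTop (𝓝 0) := by
      simpa using (tendsto_pow_atTop_nhds_zero_of_lt_one hq0.le hq1).const_mul (Real.exp m * c)
    have hex : ∃ j : ℕ, Real.exp m * c * q ^ j < t m :=
      (h1.eventually_lt_const (lt_of_lt_of_le one_pos (le_max_right _ _))).exists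
    classical
    refine ⟨Nat.find hex, fun j => ⟨fun h => not_lt.1 (Nat.find_min hex h), fun h => ?_⟩⟩
    by_contra hj
    have h2 := Nat.find_spec hex
    have h3 := pow_le_pow_of_le_one hq0.le hq1.le (not_lt.1 hj)
    have h4 : Real.exp m * c * q ^ j ≤ Real.exp m * c * q ^ Nat.find hex := by gcongr
    linarith
  choose k hk using hfin
  -- The event that some controlled level deviates at some grid point of the block `m`.
  set B : ℕ → Set Ω := fun m => ⋃ i ∈ Finset.range (I + 1), ⋃ j ∈ Finset.range (k m),
    {ω | θ * (grid I m i * μ.real (A j)) <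
      |(visits T (A j) (grid I m i) ω : ℝ) - grid I m i * μ.real (A j)|} with hB
  set Q : ℝ := (I + 1) * (2 * (4 / a * (1 - q)⁻¹)) with hQ
  have hBμ : ∀ m, μ.real (B m) ≤ Q * (1 / ψ m) := by
    intro m
    have hψm : 0 < ψ m := hψ.1 m
    have hterm : ∀ i j, j ∈ Finset.range (k m) →
        μ.real {ω | θ * (grid I m i * μ.real (A j)) <
          |(visits T (A j) (grid I m i) ω : ℝ) - grid I m i * μ.real (A j)|} ≤
        2 * (1 / ψ m * (4 / a * (Real.exp m * c * q ^ j)⁻¹)) := by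
      intro i j hj
      refine (hconc (A j) (hA j) (hAF j) (grid I m i)).trans ?_
      have hx := (hk m j).1 (Finset.mem_range.1 hj)
      set x := Real.exp m * c * q ^ j with hxdef
      have hx0 : 0 < x := by positivity
      have h1 : x / 2 ≤ grid I m i * μ.real (A j) := by
        rw [hAμ]
        calc x / 2 = Real.exp m / 2 * (c * q ^ j) := by rw [hxdef]; ring
          _ ≤ _ := by gcongr; exact exp_div_two_le_grid I m i
      have h2 : Real.log (ψ m) ≤ a * x / 4 := by
        have h3 := (le_max_left _ _).trans hx
        have h4 : Real.log (ψ m) = a / 4 * (4 / a * Real.log (ψ m)) := by field_simp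
        rw [h4]
        calc _ ≤ a / 4 * x := by gcongr
          _ = _ := by ring
      have h5 : Real.exp (-(a * x / 4)) ≤ 4 / a * x⁻¹ := by
        have h6 : 4 / a * x⁻¹ = (a * x / 4)⁻¹ := by field_simp
        rw [Real.exp_neg, h6]
        refine inv_anti₀ (by positivity) ?_
        have := Real.add_one_le_exp (a * x / 4)
        linarith
      gcongr
      calc Real.exp (-(a * (grid I m i * μ.real (A j))))
          ≤ Real.exp (-Real.log (ψ m) + -(a * x / 4)) := by
            refine Real.exp_le_exp.2 ?_
            have : a * (x / 2) ≤ a * (grid I m i * μ.real (A j)) := by gcongr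
            linarith
        _ = 1 / ψ m * Real.exp (-(a * x / 4)) := by
            rw [Real.exp_add, Real.exp_neg, Real.exp_log hψm, one_div]
        _ ≤ _ := by gcongr
    have hsum : ∑ j ∈ Finset.range (k m), (Real.exp m * c * q ^ j)⁻¹ ≤ (1 - q)⁻¹ :=
      sum_range_inv_geometric_le hq0 hq1 (by positivity) fun j hj =>
        (le_max_right _ _).trans ((hk m j).1 hj)
    calc μ.real (B m) ≤ ∑ i ∈ Finset.range (I + 1), ∑ j ∈ Finset.range (k m),
          2 * (1 / ψ m * (4 / a * (Real.exp m * c * q ^ j)⁻¹)) := by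
          refine (measureReal_biUnion_finset_le _ _).trans (Finset.sum_le_sum fun i _ => ?_)
          exact (measureReal_biUnion_finset_le _ _).trans (Finset.sum_le_sum fun j => hterm i j)
      _ = (I + 1) * (2 * (1 / ψ m * (4 / a *
          ∑ j ∈ Finset.range (k m), (Real.exp m * c * q ^ j)⁻¹))) := by
          rw [Finset.sum_const, Finset.card_range, nsmul_eq_mul]
          simp only [← Finset.mul_sum]
          push_cast; ring
      _ ≤ (I + 1) * (2 * (1 / ψ m * (4 / a * (1 - q)⁻¹))) := by gcongr
      _ = _ := by rw [hQ]; ring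
  have hBC : ∑' m, μ (B m) ≠ ⊤ := by
    have h1 : ∀ m, μ (B m) ≤ ENNReal.ofReal (Q * (1 / ψ m)) := fun m => by
      rw [← ofReal_measureReal (h := measure_ne_top μ _)]
      exact ENNReal.ofReal_le_ofReal (hBμ m)
    exact ne_top_of_le_ne_top (hψ.2.mul_left Q).tsum_ofReal_ne_top (ENNReal.tsum_le_tsum h1)
  have hlogtend : Tendsto (fun n : ℕ => ⌊Real.log n⌋₊) atTop atTop :=
    tendsto_nat_floor_atTop.comp (Real.tendsto_log_atTop.comp tendsto_natCast_atTop_atTop)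
  have hb' : Tendsto (fun n => (b n : ℝ)) atTop atTop := tendsto_natCast_atTop_atTop.comp hb
  filter_upwards [ae_eventually_notMem hBC] with ω hω
  filter_upwards [hlogtend.eventually hω,
    eventually_exists_grid hθ0 (by rw [hθ]; linarith) hI',
    hbψ.eventually_ge_atTop (4 / a * Real.exp 1 / κ),
    hb'.eventually_ge_atTop (Real.exp 1 / κ), eventually_ge_atTop 1]
    with n hn1 hn2 hn3 hn4 hn5 j hj
  have hn0 : (0 : ℝ) < n := by exact_mod_cast hn5
  obtain ⟨i, hi, hg1, hg2, hg3, hg4⟩ := hn2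
  set m := ⌊Real.log n⌋₊ with hm
  set p := c * q ^ j with hp
  have hp0 : 0 < p := by positivity
  have hnm : n * p ≤ Real.exp 1 * (Real.exp m * p) := by
    rw [← mul_assoc (Real.exp 1), ← Real.exp_add]
    gcongr
    rw [← Real.log_le_iff_le_exp hn0, add_comm]
    exact (Nat.lt_floor_add_one _).le
  have he : 0 < Real.exp 1 := Real.exp_pos 1
  have hjk : j < k m := by
    rw [hk m j]
    refine max_le ?_ ?_
    · rcases le_or_gt (Real.log (ψ m)) 0 with h | h
      · exact (mul_nonpos_of_nonneg_of_nonpos (by positivity) h).trans (by positivity)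
      · rw [le_div_iff₀ h, div_mul_eq_mul_div, div_le_iff₀ hκ] at hn3
        refine le_of_mul_le_mul_left ?_ he
        rw [mul_assoc (Real.exp m)]
        linarith
    · rw [div_le_iff₀ hκ] at hn4
      refine le_of_mul_le_mul_left ?_ he
      rw [mul_assoc (Real.exp m)]
      linarith
  have hgood : ∀ i < I + 1, |(visits T (A j) (grid I m i) ω : ℝ) - grid I m i * p| ≤
      θ * (grid I m i * p) := by
    intro i hi
    by_contra hcon
    refine hn1 ?_
    simp only [hB, Set.mem_iUnion, Finset.mem_range]
    refine ⟨i, hi, j, hjk, ?_⟩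
    rw [Set.mem_ofPred_eq, hAμ]
    exact not_le.1 hcon
  have h1 := (abs_le.1 (hgood i (by omega))).1
  have h2 := (abs_le.1 (hgood (i + 1) (by omega))).2
  have h3 : (visits T (A j) (grid I m i) ω : ℝ) ≤ visits T (A j) n ω :=
    Nat.cast_le.2 (visits_mono T (A j) ω hg1)
  have h4 : (visits T (A j) n ω : ℝ) ≤ visits T (A j) (grid I m (i + 1)) ω :=
    Nat.cast_le.2 (visits_mono T (A j) ω hg2)
  have h5 : (1 - 2 * θ) * n * p ≤ grid I m i * p := by gcongr
  have h6 : grid I m (i + 1) * p ≤ (1 + 2 * θ) * n * p := by gcongr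
  have hδθ : δ = 5 * θ := by rw [hθ]; ring
  have hθ1 : θ < 1 := by linarith
  have hnp : 0 < n * p := by positivity
  rw [abs_le, hδθ]
  constructor
  · have h7 : (1 - θ) * ((1 - 2 * θ) * n * p) ≤ (1 - θ) * (grid I m i * p) :=
      mul_le_mul_of_nonneg_left h5 (by linarith)
    nlinarith [mul_pos (mul_pos hθ0 hθ0) hnp, mul_pos hθ0 hnp]
  · have h7 : (1 + θ) * (grid I m (i + 1) * p) ≤ (1 + θ) * ((1 + 2 * θ) * n * p) :=
      mul_le_mul_of_nonneg_left h6 (by linarith)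
    nlinarith [mul_pos hθ0 (mul_pos (sub_pos.2 hθ1) hnp), mul_pos hθ0 hnp]

end levels

/-! ### Convergence of the trimmed sums -/

section limit

theorem visits_subset {Ω : Type*} (T : Ω → Ω) {A B : Set Ω} (hAB : A ⊆ B) (n : ℕ) (ω : Ω) :
    visits T A n ω ≤ visits T B n ω := by
  classical
  exact Finset.card_le_card (Finset.monotone_filter_right _ fun i _ hi => hAB hi)

theorem measureReal_lt_level {Ω : Type*} [MeasurableSpace Ω] {μ : Measure Ω} {χ : Ω → ℝ}
    (hmeas : Measurable χ) {q R η : ℝ} (hq0 : 0 < q) (hq1 : q < 1) (hR : 0 < R) (hη : 1 < η)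
    (hχ : ∀ k : ℕ, 1 ≤ k → μ {ω | χ ω = η ^ k} = ENNReal.ofReal (R * q ^ k))
    (hχ' : ∀ᵐ ω ∂μ, η < χ ω → ∃ k : ℕ, χ ω = η ^ k) (j : ℕ) :
    μ.real {ω | η ^ (j + 1) < χ ω} = R * q ^ 2 / (1 - q) * q ^ j := by
  have hη0 : 0 < η := by linarith
  have hinj : Function.Injective fun k : ℕ => η ^ k := pow_right_injective₀ hη0 hη.ne'
  have hU : {ω | η ^ (j + 1) < χ ω} =ᵐ[μ] ⋃ i : ℕ, {ω | χ ω = η ^ (j + 2 + i)} := by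
    rw [eventuallyEq_set]
    filter_upwards [hχ'] with ω hω
    simp only [Set.mem_iUnion, Set.mem_ofPred_eq]
    constructor
    · intro h
      obtain ⟨k, hk⟩ := hω (lt_of_le_of_lt (le_self_pow₀ hη.le (by omega)) h)
      rw [hk] at h
      obtain ⟨i, rfl⟩ := Nat.exists_eq_add_of_lt ((pow_lt_pow_iff_right₀ hη).1 h)
      exact ⟨i, by rw [hk]; congr 1; omega⟩
    · rintro ⟨i, hi⟩
      rw [hi]
      exact pow_lt_pow_right₀ hη (by omega)
  have hdisj : Pairwise (Function.onFun Disjoint fun i : ℕ => {ω | χ ω = η ^ (j + 2 + i)}) := by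
    intro i i' hii'
    refine Set.disjoint_left.2 fun ω h1 h2 => hii' ?_
    have h3 : η ^ (j + 2 + i) = η ^ (j + 2 + i') := Eq.trans (Eq.symm h1) h2
    have := hinj h3
    omega
  have hsum : HasSum (fun i : ℕ => R * q ^ (j + 2 + i)) (R * q ^ 2 / (1 - q) * q ^ j) := by
    have e1 : R * q ^ 2 / (1 - q) * q ^ j = R * q ^ (j + 2) * (1 - q)⁻¹ := by
      rw [div_eq_mul_inv]; ring
    have e2 : (fun i : ℕ => R * q ^ (j + 2 + i)) = fun i => R * q ^ (j + 2) * q ^ i := by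
      ext i; ring
    rw [e1, e2]
    exact (hasSum_geometric_of_lt_one hq0.le hq1).mul_left _
  have hq' : 0 < 1 - q := by linarith
  rw [measureReal_def, measure_congr hU,
    measure_iUnion hdisj fun i => hmeas (measurableSet_singleton _)]
  simp_rw [fun i : ℕ => hχ (j + 2 + i) (by omega)]
  rw [← ENNReal.ofReal_tsum_of_nonneg (fun i => by positivity) hsum.summable, hsum.tsum_eq,
    ENNReal.toReal_ofReal (by positivity)]

variable {Ω 𝕜 F : Type*} [MeasurableSpace Ω] [RCLike 𝕜] {μ : Measure Ω}
  [NormedCommRing F] [NormedAlgebra 𝕜 F] {T : Ω → Ω} {ι : F →ₗ[𝕜] (Ω →ₘ[μ] 𝕜)} {χ : Ω → ℝ}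

theorem PropertyD.ae_tendsto_trimmedSum_div_normalizer (hD : PropertyD T ι χ) {q R η : ℝ}
    (hq0 : 0 < q) (hq1 : q < 1) (hR : 0 < R) (hη : 1 < η) (hqη : 1 < q * η)
    (hχ : ∀ k : ℕ, 1 ≤ k → μ {ω | χ ω = η ^ k} = ENNReal.ofReal (R * q ^ k))
    (hχ' : ∀ᵐ ω ∂μ, η < χ ω → ∃ k : ℕ, χ ω = η ^ k)
    {b : ℕ → ℕ} (hb : Tendsto b atTop atTop)
    (hbn : (fun n => (b n : ℝ)) =o[atTop] fun n => (n : ℝ)) {ψ : ℕ → ℝ} (hψ : ψ ∈ Psi)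
    (hbψ : Tendsto (fun n : ℕ => (b n : ℝ) / Real.log (ψ ⌊Real.log n⌋₊)) atTop atTop) :
    ∀ᵐ ω ∂μ, Tendsto (fun n => trimmedSum T χ n (b n) ω /
      normalizer q η (R * q ^ 2 / (1 - q)) n (b n)) atTop (𝓝 1) := by
  have hq' : 0 < 1 - q := by linarith
  have hη0 : 0 < η := by linarith
  set c := R * q ^ 2 / (1 - q) with hcdef
  have hc : 0 < c := by positivity
  obtain ⟨K₂, hK₂, hlevel⟩ := hD.level
  have hLLN : ∀ᵐ ω ∂μ, ∀ l : ℕ, ∀ᶠ n : ℕ in atTop, ∀ j, q / 2 * b n ≤ n * (c * q ^ j) →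
      |(visits T {ω | η ^ (j + 1) < χ ω} n ω : ℝ) - n * (c * q ^ j)| ≤
        1 / ((l : ℝ) + 2) * (n * (c * q ^ j)) := by
    rw [ae_all_iff]
    intro l
    refine hD.propertyC.ae_eventually_visits hK₂
      (fun j => measurableSet_lt measurable_const hD.measurable)
      (fun j => hlevel _ (by positivity)) hc hq0 hq1
      (fun j => measureReal_lt_level hD.measurable hq0 hq1 hR hη hχ hχ' j) hb hψ hbψ
      (by positivity) (by positivity) ?_
    rw [div_lt_one (by positivity)]
    linarith [(Nat.cast_nonneg l : (0 : ℝ) ≤ l)]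
  have hiter : ∀ᵐ ω ∂μ, ∀ i : ℕ, η < χ (T^[i] ω) → ∃ k : ℕ, χ (T^[i] ω) = η ^ k :=
    ae_all_iff.2 fun i =>
      (hD.propertyC.invariant.iterate i).quasiMeasurePreserving.ae hχ'
  obtain ⟨J, hJ⟩ := exists_pow_lt_of_lt_one (show (0 : ℝ) < 1 / 4 by norm_num) hq1
  -- The relative error `1 / (l + 2)` of the visits is amplified at most by the factor `C`.
  set C := 2 * (1 + (q * η) ^ J) with hC
  have hC0 : 0 < C := by positivity
  filter_upwards [hLLN, hiter] with ω hω hωi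
  rw [Metric.tendsto_nhds]
  intro ε hε
  obtain ⟨l, hl⟩ := exists_nat_gt (C * (3 / ε))
  have hl' : 1 / ((l : ℝ) + 2) * C ≤ ε / 3 := by
    rw [div_mul_eq_mul_div, one_mul, div_le_iff₀ (by positivity)]
    have h1 : C = C * (3 / ε) * (ε / 3) := by field_simp
    rw [h1]
    nlinarith
  filter_upwards [hω l, hb.eventually_gt_atTop 0,
    hbn.bound (show 0 < c * q ^ J / 2 by positivity),
    eventually_mul_le_normalizer hq0 hq1 hc hη hqη hb hbn (3 * η / ε), eventually_gt_atTop 0]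
    with n hn1 hb0 hn2 hn3 hn4
  rw [Real.norm_natCast, Real.norm_natCast] at hn2
  have hn0 : (0 : ℝ) < n := by exact_mod_cast hn4
  set D := normalizer q η c n (b n) with hDdef
  have hD0 : 0 < D := lt_of_lt_of_le (by positivity) hn3
  obtain ⟨e, he0, he1, hsum⟩ := exists_hasSum_visits T χ hη hD.nonneg ω hωi n (b n)
  have hanti : Antitone fun j : ℕ => visits T {ω | η ^ (j + 1) < χ ω} n ω := fun i j hij =>
    visits_subset T (fun ω' hω' => lt_of_le_of_lt (pow_le_pow_right₀ hη.le (by omega)) hω') n ω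
  have hmain := abs_sub_normalizer_le hq0 hq1 hc hη hJ.le hb0 (by linarith) hanti
    (by positivity) (by rw [div_le_one (by positivity)];
                        linarith [(Nat.cast_nonneg l : (0 : ℝ) ≤ l)]) hn1 hsum
  rw [← hC, ← hDdef] at hmain
  have he2 : e ≤ ε / 3 * D := by
    have h1 : n * η = ε / 3 * (3 * η / ε * n) := by field_simp
    rw [h1] at he1
    exact he1.trans (by gcongr)
  have h2 : 1 / ((l : ℝ) + 2) * C * D ≤ ε / 3 * D := by gcongr
  have h3 := abs_le.1 hmain
  rw [Real.dist_eq, div_sub_one hD0.ne', abs_div, abs_of_pos hD0, div_lt_iff₀ hD0, abs_lt]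
  have h4 : 0 < ε * D := by positivity
  constructor <;> linarith

end limit

/-! ### Asymptotics of the normalizing constants -/

section asymptotics

/-- Along a sequence `β → 1` the excess sum converges term by term, dominated by the geometric
series with ratio `(q η)⁻¹`. -/
theorem tendsto_tsum_excess {q η : ℝ} (hq0 : 0 < q) (hq1 : q ≤ 1) (hη : 1 < η)
    (hqη : 1 < q * η) {β : ℕ → ℝ} (hβ0 : ∀ᶠ n in atTop, 0 ≤ β n)
    (hβ : Tendsto β atTop (𝓝 1)) {k : ℕ → ℕ} (hk : Tendsto k atTop atTop) :
    Tendsto (fun n => ∑' i : ℕ, if i < k n - 1 then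
        (η - 1) * η⁻¹ ^ i * max (q⁻¹ ^ i - β n) 0 else 0) atTop
      (𝓝 (η * (1 - q) / (q * η - 1))) := by
  have hη0 : 0 < η := by linarith
  have hη1 : 0 < η - 1 := by linarith
  have hs1 : HasSum (fun i : ℕ => (q * η)⁻¹ ^ i) (1 - (q * η)⁻¹)⁻¹ :=
    hasSum_geometric_of_lt_one (by positivity) (inv_lt_one_of_one_lt₀ hqη)
  have hs2 : HasSum (fun i : ℕ => η⁻¹ ^ i) (1 - η⁻¹)⁻¹ :=
    hasSum_geometric_of_lt_one (by positivity) (inv_lt_one_of_one_lt₀ hη)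
  have hlim : HasSum (fun i : ℕ => (η - 1) * η⁻¹ ^ i * max (q⁻¹ ^ i - 1) 0)
      (η * (1 - q) / (q * η - 1)) := by
    have e1 : (fun i : ℕ => (η - 1) * η⁻¹ ^ i * max (q⁻¹ ^ i - 1) 0) =
        fun i => (η - 1) * ((q * η)⁻¹ ^ i - η⁻¹ ^ i) := by
      ext i
      rw [max_eq_left (sub_nonneg.2 (one_le_pow₀ ((one_le_inv₀ hq0).2 hq1))), mul_inv, mul_pow]
      ring
    have e2 : η * (1 - q) / (q * η - 1) =
        (η - 1) * ((1 - (q * η)⁻¹)⁻¹ - (1 - η⁻¹)⁻¹) := by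
      have h1 : q * η - 1 ≠ 0 := by linarith
      have h2 : η - 1 ≠ 0 := hη1.ne'
      have h3 : 1 - (q * η)⁻¹ = (q * η - 1) / (q * η) := by field_simp
      have h4 : 1 - η⁻¹ = (η - 1) / η := by field_simp
      rw [h3, h4, inv_div, inv_div, mul_sub (η - 1), mul_div_cancel₀ _ h2, div_eq_iff h1, sub_mul,
        mul_assoc, div_mul_cancel₀ _ h1]
      ring
    rw [e1, e2]
    exact (hs1.sub hs2).mul_left _
  rw [← hlim.tsum_eq]
  refine tendsto_tsum_of_dominated_convergence (hs1.summable.mul_left (η - 1)) (fun i => ?_) ?_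
  · have h1 : Tendsto (fun n => (η - 1) * η⁻¹ ^ i * max (q⁻¹ ^ i - β n) 0) atTop
        (𝓝 ((η - 1) * η⁻¹ ^ i * max (q⁻¹ ^ i - 1) 0)) :=
      ((tendsto_const_nhds.sub hβ).max tendsto_const_nhds).const_mul _
    refine h1.congr' ?_
    filter_upwards [hk.eventually_ge_atTop (i + 2)] with n hn
    rw [if_pos (by omega)]
  · filter_upwards [hβ0] with n hn i
    split_ifs
    · rw [Real.norm_of_nonneg (by positivity), mul_inv, mul_pow, mul_assoc, mul_comm (q⁻¹ ^ i)]
      gcongr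
      exact max_le (by linarith) (by positivity)
    · rw [norm_zero]; positivity

/-- The normalizing constant in terms of the excess sum, when `b = β A` for the expected number
`A` of visits above the level `η ^ (k - 1)`. -/
theorem normalizer_eq_tsum_excess {q η R : ℝ} (hq0 : 0 < q) (hq1 : q < 1) (hη : 1 < η)
    {n b k : ℕ} {A β : ℝ} (hA : A = R / (1 - q) * q ^ k * n) (hA0 : 0 < A) (hb : (b : ℝ) = A * β)
    (hβ : q ≤ β) (hk : 1 ≤ k) :
    normalizer q η (R * q ^ 2 / (1 - q)) n b = A * η ^ (k - 1) *
      ∑' i : ℕ, if i < k - 1 then (η - 1) * η⁻¹ ^ i * max (q⁻¹ ^ i - β) 0 else 0 := by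
  have hη0 : 0 < η := by linarith
  obtain ⟨k, rfl⟩ := Nat.exists_eq_add_of_le' hk
  have hq' : 1 - q ≠ 0 := by linarith
  rw [Nat.add_sub_cancel, normalizer,
    tsum_eq_sum (s := Finset.range k) fun i hi => if_neg (by simpa using hi),
    Finset.sum_congr rfl fun i hi => if_pos (Finset.mem_range.1 hi),
    tsum_eq_sum (s := Finset.range k), ← Finset.sum_range_reflect, Finset.mul_sum]
  · refine Finset.sum_congr rfl fun i hi => ?_
    obtain ⟨j, rfl⟩ := Nat.exists_eq_add_of_lt (Finset.mem_range.1 hi)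
    have e1 : i + j + 1 - 1 - i = j := by omega
    have e2 : n * (R * q ^ 2 / (1 - q) * q ^ j) - (b : ℝ) = A * (q⁻¹ ^ i - β) := by
      rw [hb, mul_sub, hA, inv_pow]
      congr 1
      field_simp
      ring
    have e3 : max (A * (q⁻¹ ^ i - β)) 0 = A * max (q⁻¹ ^ i - β) 0 := by
      rw [mul_max_of_nonneg _ _ hA0.le, mul_zero]
    rw [e1, e2, e3, inv_pow η]
    field_simp
    ring
  · intro j hj
    obtain ⟨i, rfl⟩ := Nat.exists_eq_add_of_le (show k ≤ j by simpa using hj)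
    rw [max_eq_right, mul_zero]
    have e2 : n * (R * q ^ 2 / (1 - q) * q ^ (k + i)) = A * q ^ (i + 1) := by
      rw [hA]; ring
    rw [e2, hb, ← mul_sub]
    refine mul_nonpos_of_nonneg_of_nonpos hA0.le ?_
    have : q ^ (i + 1) ≤ q := pow_le_of_le_one hq0.le hq1.le (by omega)
    linarith

/-- The closed form of the normalizing constant, in the notation of `normalizer_eq_tsum_excess`. The
exponent `a = log η / log q` is the one with `q ^ a = η`. -/
theorem closedForm_eq {q η R : ℝ} (hq0 : 0 < q) (hq1 : q < 1) (hR : 0 < R) (hη : 1 < η) {n k : ℕ}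
    (hn : 0 < n) {A β b : ℝ} (hA : A = R / (1 - q) * q ^ k * n) (hb : b = A * β) (hβ : 0 ≤ β)
    (hk : 1 ≤ k) :
    η / (q * η - 1) * (R * q) ^ (-(Real.log η / Real.log q)) *
        (1 - q) ^ (1 + Real.log η / Real.log q) * (n : ℝ) ^ (-(Real.log η / Real.log q)) *
        b ^ (1 + Real.log η / Real.log q) =
      A * η ^ (k - 1) * (η * (1 - q) / (q * η - 1) * β ^ (1 + Real.log η / Real.log q)) := by
  have hη0 : 0 < η := by linarith
  have hq' : 0 < 1 - q := by linarith
  have hn0 : (0 : ℝ) < n := Nat.cast_pos.2 hn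
  have hA0 : 0 < A := by rw [hA]; positivity
  have hlogq : Real.log q ≠ 0 := (Real.log_neg hq0 hq1).ne
  obtain ⟨k, rfl⟩ := Nat.exists_eq_add_of_le' hk
  set a := Real.log η / Real.log q with ha
  have hqa : q ^ a = η := by
    rw [Real.rpow_def_of_pos hq0, ha, mul_div_cancel₀ _ hlogq, Real.exp_log hη0]
  have hqka : (q ^ (k + 1)) ^ a = η ^ (k + 1) := by
    rw [← Real.rpow_natCast q, ← Real.rpow_mul hq0.le, mul_comm, Real.rpow_mul hq0.le, hqa,
      Real.rpow_natCast]
  have hAa : A ^ a = R ^ a / (1 - q) ^ a * η ^ (k + 1) * (n : ℝ) ^ a := by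
    rw [hA, Real.mul_rpow (by positivity) hn0.le, Real.mul_rpow (by positivity) (by positivity),
      Real.div_rpow hR.le hq'.le, hqka]
  rw [hb, Real.mul_rpow hA0.le hβ, Real.rpow_add hA0, Real.rpow_one, hAa,
    Real.rpow_neg (by positivity), Real.mul_rpow hR.le hq0.le, hqa, Real.rpow_add hq',
    Real.rpow_one, Real.rpow_neg hn0.le,
    Nat.add_sub_cancel]
  have h1 : 0 < R ^ a := by positivity
  have h2 : 0 < (1 - q) ^ a := by positivity
  have h3 : 0 < (n : ℝ) ^ a := by positivity
  field_simp
  ring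

theorem tendsto_normalizer_div {q R η : ℝ} (hq0 : 0 < q) (hq1 : q < 1) (hR : 0 < R)
    (hη : 1 < η) (hqη : 1 < q * η) {b : ℕ → ℕ}
    (hbn : (fun n => (b n : ℝ)) =o[atTop] fun n => (n : ℝ)) {k : ℕ → ℕ} {w : ℕ → ℝ}
    (hbw : ∀ᶠ n in atTop, (b n : ℝ) = R / (1 - q) * q ^ k n * n + w n)
    (hw : w =o[atTop] fun n => q ^ k n * n) :
    Tendsto (fun n : ℕ => normalizer q η (R * q ^ 2 / (1 - q)) n (b n) /
        (η / (q * η - 1) * (R * q) ^ (-(Real.log η / Real.log q)) *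
          (1 - q) ^ (1 + Real.log η / Real.log q) *
          (n : ℝ) ^ (-(Real.log η / Real.log q)) *
          (b n : ℝ) ^ (1 + Real.log η / Real.log q))) atTop (𝓝 1) := by
  have hη0 : 0 < η := by linarith
  have hq' : 0 < 1 - q := by linarith
  set a := Real.log η / Real.log q with ha
  set A : ℕ → ℝ := fun n => R / (1 - q) * q ^ k n * n with hA
  have hA0 : ∀ n : ℕ, 0 < n → 0 < A n := fun n hn => by
    have : (0 : ℝ) < n := Nat.cast_pos.2 hn
    simp only [hA]; positivity
  set β : ℕ → ℝ := fun n => b n / A n with hβdef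
  have hbA : ∀ n : ℕ, 0 < n → (b n : ℝ) = A n * β n := fun n hn => by
    simp only [hβdef]; field_simp [(hA0 n hn).ne']
  have hβ : Tendsto β atTop (𝓝 1) := by
    have h1 : Tendsto (fun n => 1 + (1 - q) / R * (w n / (q ^ k n * n))) atTop (𝓝 1) := by
      simpa using (hw.tendsto_div_nhds_zero.const_mul ((1 - q) / R)).const_add 1
    refine h1.congr' ?_
    filter_upwards [hbw, eventually_gt_atTop 0] with n hn hn0
    have : (0 : ℝ) < n := Nat.cast_pos.2 hn0
    simp only [hβdef, hA, hn]
    field_simp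
  -- `q ^ k n` is comparable to `b n / n`, hence tends to zero.
  have hk : Tendsto k atTop atTop := by
    have h1 : Tendsto (fun n => (1 - q) / R * ((b n / n : ℝ) / β n)) atTop (𝓝 0) := by
      simpa using (hbn.tendsto_div_nhds_zero.div hβ one_ne_zero).const_mul ((1 - q) / R)
    have h2 : Tendsto (fun n => q ^ k n) atTop (𝓝 0) := by
      refine h1.congr' ?_
      filter_upwards [eventually_gt_atTop 0, hβ.eventually_const_lt one_pos] with n hn0 hβn
      have : (0 : ℝ) < n := Nat.cast_pos.2 hn0
      rw [hbA n hn0]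
      simp only [hA]
      field_simp
    rw [tendsto_atTop]
    intro K
    filter_upwards [h2.eventually_lt_const (pow_pos hq0 K)] with n hn
    exact ((pow_lt_pow_iff_right_of_lt_one₀ hq0 hq1).1 hn).le
  have hβ0 : ∀ᶠ n in atTop, 0 ≤ β n := (hβ.eventually_const_lt one_pos).mono fun n h => h.le
  set L := η * (1 - q) / (q * η - 1) with hL
  have hL0 : L ≠ 0 := (div_pos (by positivity) (by linarith)).ne'
  have hβa : Tendsto (fun n => L * β n ^ (1 + a)) atTop (𝓝 L) := by
    simpa using (hβ.rpow_const (p := 1 + a) (Or.inl one_ne_zero)).const_mul L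
  have hmain := (tendsto_tsum_excess hq0 hq1.le hη hqη hβ0 hβ hk).div hβa hL0
  rw [← hL, div_self hL0] at hmain
  refine hmain.congr' ?_
  filter_upwards [eventually_gt_atTop 0, hβ.eventually_const_lt hq1, hk.eventually_ge_atTop 1]
    with n hn hβn hkn
  have hX : A n * η ^ (k n - 1) ≠ 0 := (mul_pos (hA0 n hn) (by positivity)).ne'
  rw [normalizer_eq_tsum_excess (A := A n) (β := β n) hq0 hq1 hη rfl (hA0 n hn)
      (hbA n hn) hβn.le hkn,
    closedForm_eq (A := A n) (β := β n) hq0 hq1 hR hη hn rfl (hbA n hn) (hq0.le.trans hβn.le) hkn,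
    mul_div_mul_left _ _ hX]
  rfl

end asymptotics

end TrimmedSums

theorem mainTheorem3
    {Ω 𝕜 F : Type*} [MeasurableSpace Ω] [RCLike 𝕜] [NormedCommRing F] [NormedAlgebra 𝕜 F]
    (μ : Measure Ω) (T : Ω → Ω) (ι : F →ₗ[𝕜] (Ω →ₘ[μ] 𝕜)) (χ : Ω → ℝ)
    (hD : TrimmedSums.PropertyD T ι χ)
    (hK₃ : ∃ K₃ > 0, ∀ ℓ > 0, TrimmedSums.MemNormLE ι ({ω | χ ω = ℓ}.indicator 1) K₃)
    (q R η : ℝ) (hq : q ∈ Set.Ioo (0 : ℝ) 1) (hR : R ∈ Set.Ioo 0 (1 / q)) (hη : 1 / q < η)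
    (hχ : ∀ k : ℕ, 1 ≤ k → μ {ω | χ ω = η ^ k} = ENNReal.ofReal (R * q ^ k))
    (hχ' : ∀ᵐ ω ∂μ, η < χ ω → ∃ k : ℕ, χ ω = η ^ k)
    (b : ℕ → ℕ) (hb : Tendsto b atTop atTop)
    (hbn : (fun n => (b n : ℝ)) =o[atTop] fun n => (n : ℝ))
    (ψ : ℕ → ℝ) (hψ : ψ ∈ TrimmedSums.Psi)
    (hbψ : Tendsto (fun n : ℕ => (b n : ℝ) / Real.log (ψ ⌊Real.log n⌋₊)) atTop atTop) :
    (∃ d : ℕ → ℝ, (∀ n, 0 < d n) ∧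
      ∀ᵐ ω ∂μ, Tendsto (fun n => TrimmedSums.trimmedSum T χ n (b n) ω / d n) atTop (𝓝 1)) ∧
    (∀ (ε : ℝ) (k : ℕ → ℕ) (w : ℕ → ℝ), 0 < ε →
      (∀ᶠ n in atTop, (b n : ℝ) = R / (1 - q) * q ^ k n * n + w n) →
      (∀ᶠ n : ℕ in atTop, (q ^ k n * n) ^ (1 / 2 + ε) *
        Real.log (ψ ⌊Real.log n⌋₊) ^ (1 / 2 - ε) ≤ w n) →
      (w =o[atTop] fun n => q ^ k n * n) →
      ∀ᵐ ω ∂μ, Tendsto (fun n : ℕ => TrimmedSums.trimmedSum T χ n (b n) ω /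
        (η / (q * η - 1) * (R * q) ^ (-(Real.log η / Real.log q)) *
          (1 - q) ^ (1 + Real.log η / Real.log q) *
          (n : ℝ) ^ (-(Real.log η / Real.log q)) *
          (b n : ℝ) ^ (1 + Real.log η / Real.log q))) atTop (𝓝 1)) := by
  have hq0 : 0 < q := hq.1
  have hq1 : q < 1 := hq.2
  have hη1 : 1 < η := ((one_lt_div hq0).2 hq1).trans hη
  have hqη : 1 < q * η := by rwa [div_lt_iff₀' hq0] at hη
  have hc : 0 < R * q ^ 2 / (1 - q) :=
    div_pos (mul_pos hR.1 (pow_pos hq0 2)) (sub_pos.2 hq1)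
  have hpos : ∀ᶠ n : ℕ in atTop,
      0 < TrimmedSums.normalizer q η (R * q ^ 2 / (1 - q)) n (b n) := by
    filter_upwards [TrimmedSums.eventually_mul_le_normalizer hq0 hq1 hc hη1 hqη hb hbn 1,
      eventually_gt_atTop 0] with n h1 h2
    refine lt_of_lt_of_le ?_ h1
    rw [one_mul]
    exact_mod_cast h2
  have hmain := hD.ae_tendsto_trimmedSum_div_normalizer hq0 hq1 hR.1 hη1 hqη hχ hχ' hb hbn hψ hbψ
  constructor
  · -- For the finitely many `n` with a vanishing normalizing constant, any positive value will do.
    refine ⟨fun n => if 0 < TrimmedSums.normalizer q η (R * q ^ 2 / (1 - q)) n (b n) then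
      TrimmedSums.normalizer q η (R * q ^ 2 / (1 - q)) n (b n) else 1, fun n => ?_, ?_⟩
    · dsimp only
      split_ifs with h
      · exact h
      · exact one_pos
    · filter_upwards [hmain] with ω hω
      refine hω.congr' ?_
      filter_upwards [hpos] with n hn
      rw [if_pos hn]
  · intro ε k w _ hbw _ hw
    have hdet := TrimmedSums.tendsto_normalizer_div hq0 hq1 hR.1 hη1 hqη hbn hbw hw
    filter_upwards [hmain] with ω hω
    have h := hω.mul hdet
    rw [one_mul] at h
    refine h.congr' ?_
    filter_upwards [hpos] with n hn
    exact div_mul_div_cancel₀ hn.ne'
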